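/- All graphs are finite and loopless and may have parallel edges. For a set $S$ of vertices of a graph $G$, let $\partial(S)$ be the set of edges with exactly one end in $S$. An $r$-regular graph $G$ is an *$r$-graph* if $|\partial(S)|\ge r$ for every $S\subseteq V(G)$ of odd cardinality. An *automorphism* of $G$ is a bijection $\alpha\colon V(G)\to V(G)$ such that for all vertices $u,v$ the number of edges between $\alpha(u)$ and $\alpha(v)$ equals the number of edges between $u$ and $v$. For an integer $i$, $T_i^r$ denotes the (unique) tree that has all vertex degrees in $\{1,r\}$ and a vertex, called the *root*, at distance $i$ from every leaf. An automorphism $\alpha$ of a tree $T$ is *rotational* with respect to a vertex $x$ of $T$ if $\alpha(x)=x$ and, for every vertex $u\ne x$ of $T$, the least positive integer $m$ with $\alpha^m(u)=u$ equals the degree of $x$ in $T$. A *rotation $r$-graph* is an $r$-graph $G$ that, for some integer $i$, has a spanning tree $T$ isomorphic to $T_i^r$ and an automorphism that is also an automorphism of $T$ and is rotational on $T$ with respect to the root of $T$. A graph is *simple* if it has no parallel edges. **Corollary.** Let $r$ be an odd integer and let $k$ be an integer with $2\le k\le r-1$. Then the following two statements are equivalent. 1. Every $r$-graph $G$ has $r$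 perfect matchings $M_1,\dots,M_r$ (not necessarily distinct) such that each edge of $G$ belongs to at most $k$ of them. 2. Every simple rotation $r$-graph $G$ has $r$ perfect matchings $M_1,\dots,M_r$ (not necessarily distinct) such that each edge of $G$ belongs to at most $k$ of them. -/

import Mathlib

universe u

namespace Graph

/-- The degree of `v`: the number of edges incident with `v` (all graphs below are loopless). -/
noncomputable def degree {α β : Type*} (G : Graph α β) (v : α) : ℕ :=
  (G.incidenceSet v).ncard

/-- `∂(S)`: the set of edges with precisely one end in `S`. -/
def edgeBoundary {α β : Type*} (G : Graph α β) (S : Set α) : Set β :=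
  {e | ∃ x y, G.IsLink e x y ∧ x ∈ S ∧ y ∉ S}

/-- The number of edges between `x` and `y`. -/
noncomputable def multiplicity {α β : Type*} (G : Graph α β) (x y : α) : ℕ :=
  {e | G.IsLink e x y}.ncard

/-- An `r`-graph: a finite loopless `r`-regular graph (parallel edges allowed, not necessarily
simple or connected) such that `|∂(S)| ≥ r` for every set `S` of vertices of odd cardinality. -/
structure IsRGraph {α β : Type*} (G : Graph α β) (r : ℕ) : Prop where
  finite_vertexSet : V(G).Finite
  finite_edgeSet : E(G).Finite
  loopless : G.Loopless
  regular : ∀ v ∈ V(G), G.degree v = r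
  le_boundary : ∀ S ⊆ V(G), Odd S.ncard → r ≤ (G.edgeBoundary S).ncard

/-- A bijection of the vertex set preserving the number of edges between any two vertices. -/
structure IsAutomorphism {α β : Type*} (G : Graph α β) (σ : α → α) : Prop where
  bijOn : Set.BijOn σ V(G) V(G)
  multiplicity_eq : ∀ x ∈ V(G), ∀ y ∈ V(G), G.multiplicity (σ x) (σ y) = G.multiplicity x y

/-- A tree: connected, nonempty, without cycles (in particular without loops and parallel edges). -/
structure IsTree {α β : Type*} (T : Graph α β) : Prop where
  simple : T.Simple
  isTree : T.toSimpleGraph.IsTree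

/-- `T` is (isomorphic to) the tree `T_i^r` and `x` is its root: all vertex degrees are `1` or `r`,
and every leaf is at distance exactly `i` from `x`. -/
structure IsBalancedTree {α β : Type*} (T : Graph α β) (r i : ℕ) (x : V(T)) : Prop where
  isTree : T.IsTree
  degree_eq : ∀ v ∈ V(T), T.degree v = 1 ∨ T.degree v = r
  dist_leaf : ∀ v : V(T), T.degree v = 1 → T.toSimpleGraph.dist x v = i

/-- The automorphism `σ` of the tree `T` is rotational with respect to `x`: it fixes `x`, and for
every other vertex `v` the least `k > 0` with `σ^k v = v` is the degree of `x` in `T`. -/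
structure IsRotational {α β : Type*} (T : Graph α β) (σ : α → α) (x : α) : Prop where
  isAutomorphism : T.IsAutomorphism σ
  fixed : Function.minimalPeriod σ x = 1
  period : ∀ v ∈ V(T), v ≠ x → Function.minimalPeriod σ v = T.degree x

/-- A rotation `r`-graph: an `r`-graph with, for some `i`, a spanning tree `T` isomorphic to
`T_i^r`, and an automorphism that is rotational on `T` with respect to the root of `T`. -/
def IsRotationRGraph {α β : Type*} (G : Graph α β) (r : ℕ) : Prop :=
  G.IsRGraph r ∧ ∃ (i : ℕ) (T : Graph α β) (x : V(T)) (σ : α → α),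
    T ≤s G ∧ T.IsBalancedTree r i x ∧ G.IsAutomorphism σ ∧ T.IsRotational σ x

/-- A set of edges such that every vertex is incident with exactly one of them. -/
structure IsPerfectMatching {α β : Type*} (G : Graph α β) (M : Set β) : Prop where
  subset : M ⊆ E(G)
  existsUnique : ∀ v ∈ V(G), ∃! e, e ∈ M ∧ G.Inc e v

/-- `G` has `r` perfect matchings (a family, repetitions allowed) such that each edge is in at
most `k` of them. -/
def HasPerfectMatchings {α β : Type*} (G : Graph α β) (r k : ℕ) : Prop :=
  ∃ M : Fin r → Set β, (∀ j, G.IsPerfectMatching (M j)) ∧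
    ∀ e ∈ E(G), {j | e ∈ M j}.ncard ≤ k

end Graph

/-! One implication is immediate, since rotation `r`-graphs are `r`-graphs. For the other, an
`r`-graph `G` is turned into a simple rotation `r`-graph `H` whose perfect matchings restrict to
perfect matchings of `G` with no larger multiplicities. Components of `G` are handled one at a time.
As `r` is odd and `r > 1`, there is no bridge, so a component has a spanning tree avoiding some edge
`rootEdge` at its root (`IsRGraph.exists_rootedTree`).

`H` consists of a vertex `top` and `r` copies of `G` indexed by `ZMod r`, the root of each being
joined to `top` in place of `rootEdge`. Every other end of a non-tree edge receives its own
truncated regular tree of reduced words, cut off so that all leaves are equally far from `top`. A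
leaf needs `r - 1` more edges, one for each color `d` other than its last letter `c`: the reflection
`c ↦ 2 * d - c` is applied to the longest alternating final segment (`flip`). This fails only for
the words alternating between `0` and `2 * d`; these are joined to the tree at the other end of the
same old edge or, for `rootEdge`, to the tree in copy `j + 2 * d`. Oddness of `r` excludes loops and
parallel edges. The construction commutes with `j ↦ j + 1`, which is the rotation.

`H` is an `r`-graph (`isRGraph_rotGraph`): an odd set meets some part of `H` in an odd number of
vertices. If the part is `top` with the words at `rootEdge`, or the words at another edge in one
copy, the colors give `r` disjoint perfect matchings of it, once the edges leaving the part are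
completed to edge-disjoint walks outside; each matching then yields a cut edge. If the part is the
old vertices of one copy, the cut condition of `G` is used, with edges of `G` replaced by
edge-disjoint walks.

A perfect matching of `H` restricts to `G` through copy `0` (`lift_mem_iff`): what replaces a
non-tree edge is separated by a two-edge cut with an even side, and a perfect matching contains both
edges of such a cut or neither. -/

namespace Graph

open Set

/-! ### Parity of cuts, splitting along empty cuts, and rooted spanning trees -/

section General

variable {α β : Type*}

/-- Handshake lemma modulo two for a set `M` of edges with odd degree at each vertex of `S`. -/
lemma odd_ncard_iff_odd_ncard_inter_edgeBoundary {G : Graph α β} (hG : G.Loopless)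
    {M : Set β} (hM : M.Finite) (hME : M ⊆ E(G)) {S : Set α} (hS : S.Finite)
    (h : ∀ v ∈ S, Odd {e | e ∈ M ∧ G.Inc e v}.ncard) :
    Odd S.ncard ↔ Odd (M ∩ G.edgeBoundary S).ncard := by
  classical
  lift M to Finset β using hM
  lift S to Finset α using hS
  have h1 := Finset.sum_card_bipartiteAbove_eq_sum_card_bipartiteBelow
    (s := S) (t := M) (fun v e => G.Inc e v)
  have h2 : Odd (∑ v ∈ S, (Finset.bipartiteAbove (fun v e => G.Inc e v) M v).card) ↔
      Odd S.card := by
    rw [Finset.odd_sum_iff_odd_card_odd, Finset.filter_true_of_mem]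
    intro v hv
    have := h v (by simpa using hv)
    rw [← Set.ncard_coe_finset]
    convert this using 2
    ext e; simp [Finset.bipartiteAbove]
  have h3 : Odd (∑ e ∈ M, (Finset.bipartiteBelow (fun v e => G.Inc e v) S e).card) ↔
      Odd ((M : Set β) ∩ G.edgeBoundary S).ncard := by
    rw [Finset.odd_sum_iff_odd_card_odd, ← Set.ncard_coe_finset]
    suffices hs : ((M.filter fun e =>
        Odd (Finset.bipartiteBelow (fun v e => G.Inc e v) S e).card : Finset β) : Set β) =
        (M : Set β) ∩ G.edgeBoundary S by rw [hs]
    ext e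
    simp only [Finset.coe_filter, mem_ofPred_eq, mem_inter_iff, Finset.mem_coe]
    refine and_congr_right fun he => ?_
    obtain ⟨x, y, hxy⟩ := exists_isLink_of_mem_edgeSet (hME he)
    have hne : x ≠ y := hxy.ne
    have hbl : Finset.bipartiteBelow (fun v e => G.Inc e v) S e = S ∩ {x, y} := by
      ext v
      simp only [Finset.bipartiteBelow, Finset.mem_filter, Finset.mem_inter, Finset.mem_insert,
        Finset.mem_singleton]
      refine and_congr_right fun _ => ⟨fun hv => hv.eq_or_eq_of_isLink hxy, ?_⟩
      rintro (rfl | rfl)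
      exacts [hxy.inc_left, hxy.inc_right]
    have hbd : e ∈ G.edgeBoundary S ↔ (x ∈ S ∧ y ∉ S) ∨ (y ∈ S ∧ x ∉ S) := by
      constructor
      · rintro ⟨a, b, hab, ha, hb⟩
        rcases hab.eq_and_eq_or_eq_and_eq hxy with ⟨rfl, rfl⟩ | ⟨rfl, rfl⟩
        · exact Or.inl ⟨by simpa using ha, by simpa using hb⟩
        · exact Or.inr ⟨by simpa using ha, by simpa using hb⟩
      · rintro (⟨ha, hb⟩ | ⟨ha, hb⟩)
        · exact ⟨x, y, hxy, by simpa using ha, by simpa using hb⟩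
        · exact ⟨y, x, hxy.symm, by simpa using ha, by simpa using hb⟩
    rw [hbl, hbd]
    by_cases hx : x ∈ S <;> by_cases hy : y ∈ S
    · have : S ∩ {x, y} = {x, y} := by grind
      simp [this, hx, hy, Finset.card_pair hne]
    · have : S ∩ {x, y} = {x} := by grind
      simp [this, hx, hy]
    · have : S ∩ {x, y} = {y} := by grind
      simp [this, hx, hy]
    · have : S ∩ {x, y} = ∅ := by grind
      simp [this, hx, hy]
  rw [Set.ncard_coe_finset, ← h2, h1, h3]

/-- The handshake lemma for the whole edge set, in which all degrees are the odd number `r`. It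
makes one side of a bridge odd, which rules bridges out. -/
lemma IsRGraph.odd_ncard_iff {G : Graph α β} {r : ℕ} (h : G.IsRGraph r) (hr : Odd r) {S : Set α}
    (hS : S ⊆ V(G)) : Odd S.ncard ↔ Odd (G.edgeBoundary S).ncard := by
  have hb : E(G) ∩ G.edgeBoundary S = G.edgeBoundary S :=
    inter_eq_right.2 fun e ⟨x, y, hxy, _⟩ => hxy.edge_mem
  rw [odd_ncard_iff_odd_ncard_inter_edgeBoundary h.loopless h.finite_edgeSet subset_rfl
    (h.finite_vertexSet.subset hS), hb]
  intro v hv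
  have : {e | e ∈ E(G) ∧ G.Inc e v} = G.incidenceSet v := by
    ext e
    exact ⟨fun h => h.2, fun h => ⟨h.edge_mem, h⟩⟩
  rw [this]
  have hd := h.regular v (hS hv)
  unfold degree at hd
  rwa [hd]

section Induce

variable {G : Graph α β} {C : Set α}

lemma isLink_mem_iff_of_edgeBoundary_eq_empty (hC : G.edgeBoundary C = ∅) {e : β} {x y : α}
    (h : G.IsLink e x y) : x ∈ C ↔ y ∈ C := by
  constructor
  · intro hx
    by_contra hy
    exact (hC ▸ (⟨x, y, h, hx, hy⟩ : e ∈ G.edgeBoundary C) : e ∈ (∅ : Set β))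
  · intro hy
    by_contra hx
    exact (hC ▸ (⟨y, x, h.symm, hy, hx⟩ : e ∈ G.edgeBoundary C) : e ∈ (∅ : Set β))

lemma induce_inc_iff_of_edgeBoundary_eq_empty (hC : G.edgeBoundary C = ∅) {e : β} {x : α} :
    (G.induce C).Inc e x ↔ G.Inc e x ∧ x ∈ C := by
  constructor
  · rintro ⟨y, hy⟩
    rw [induce_isLink] at hy
    exact ⟨⟨y, hy.1⟩, hy.2.1⟩
  · rintro ⟨⟨y, hy⟩, hx⟩
    exact ⟨y, (induce_isLink ..).mpr ⟨hy, hx, (isLink_mem_iff_of_edgeBoundary_eq_empty hC hy).1 hx⟩⟩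

lemma IsRGraph.induce {r : ℕ} (h : G.IsRGraph r) (hCV : C ⊆ V(G)) (hC : G.edgeBoundary C = ∅) :
    (G.induce C).IsRGraph r where
  finite_vertexSet := h.finite_vertexSet.subset hCV
  finite_edgeSet := h.finite_edgeSet.subset (induce_le hCV).edgeSet_mono
  loopless := by have := h.loopless; exact this.anti (induce_le hCV)
  regular v hv := by
    rw [← h.regular v (hCV hv)]
    unfold degree
    congr 1
    ext e
    exact (induce_inc_iff_of_edgeBoundary_eq_empty hC).trans (and_iff_left hv)
  le_boundary S hS hodd := by
    refine (h.le_boundary S (hS.trans hCV) hodd).trans_eq ?_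
    congr 1
    ext e
    constructor
    · rintro ⟨x, y, hxy, hx, hy⟩
      exact ⟨x, y, (induce_isLink ..).mpr ⟨hxy, hS hx,
        (isLink_mem_iff_of_edgeBoundary_eq_empty hC hxy).1 (hS hx)⟩, hx, hy⟩
    · rintro ⟨x, y, hxy, hx, hy⟩
      exact ⟨x, y, ((induce_isLink ..).mp hxy).1, hx, hy⟩

lemma edgeBoundary_diff_eq_empty (hC : G.edgeBoundary C = ∅) :
    G.edgeBoundary (V(G) \ C) = ∅ := by
  ext e
  simp only [mem_empty_iff_false, iff_false]
  rintro ⟨x, y, hxy, hx, hy⟩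
  exact hx.2 ((isLink_mem_iff_of_edgeBoundary_eq_empty hC hxy).2
    (by_contra fun h => hy ⟨hxy.right_mem, h⟩))

/-- The two families are united index by index. Every edge lies on one side only, so multiplicities
do not add up. -/
lemma HasPerfectMatchings.of_induce {r k : ℕ} (hC : G.edgeBoundary C = ∅)
    (hCV : C ⊆ V(G))
    (h1 : (G.induce C).HasPerfectMatchings r k)
    (h2 : (G.induce (V(G) \ C)).HasPerfectMatchings r k) : G.HasPerfectMatchings r k := by
  obtain ⟨M, hM, hMk⟩ := h1
  obtain ⟨N, hN, hNk⟩ := h2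
  have hD := edgeBoundary_diff_eq_empty hC
  have hCi := fun e x => induce_inc_iff_of_edgeBoundary_eq_empty hC (e := e) (x := x)
  have hDi := fun e x => induce_inc_iff_of_edgeBoundary_eq_empty hD (e := e) (x := x)
  have hMi : ∀ j e x, e ∈ M j → G.Inc e x → x ∈ C := by
    rintro j e x he ⟨y, hy⟩
    obtain ⟨a, b, hab⟩ := exists_isLink_of_mem_edgeSet ((hM j).subset he)
    rw [induce_isLink] at hab
    rcases hy.left_eq_or_eq hab.1 with rfl | rfl
    exacts [hab.2.1, hab.2.2]
  have hNi : ∀ j e x, e ∈ N j → G.Inc e x → x ∉ C := by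
    rintro j e x he ⟨y, hy⟩
    obtain ⟨a, b, hab⟩ := exists_isLink_of_mem_edgeSet ((hN j).subset he)
    rw [induce_isLink] at hab
    rcases hy.left_eq_or_eq hab.1 with rfl | rfl
    exacts [hab.2.1.2, hab.2.2.2]
  refine ⟨fun j => M j ∪ N j, fun j => ⟨?_, fun v hv => ?_⟩, fun e he => ?_⟩
  · exact union_subset ((hM j).subset.trans (induce_le hCV).edgeSet_mono)
      ((hN j).subset.trans (induce_le sdiff_subset).edgeSet_mono)
  · by_cases hvC : v ∈ C
    · obtain ⟨e, ⟨he, hev⟩, hu⟩ := (hM j).existsUnique v hvC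
      refine ⟨e, ⟨Or.inl he, ((hCi e v).1 hev).1⟩, ?_⟩
      rintro f ⟨hf | hf, hfv⟩
      · exact hu f ⟨hf, (hCi f v).2 ⟨hfv, hvC⟩⟩
      · exact absurd hvC (hNi j f v hf hfv)
    · obtain ⟨e, ⟨he, hev⟩, hu⟩ := (hN j).existsUnique v ⟨hv, hvC⟩
      refine ⟨e, ⟨Or.inr he, ((hDi e v).1 hev).1⟩, ?_⟩
      rintro f ⟨hf | hf, hfv⟩
      · exact absurd (hMi j f v hf hfv) hvC
      · exact hu f ⟨hf, (hDi f v).2 ⟨hfv, hv, hvC⟩⟩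
  · obtain ⟨x, y, hxy⟩ := exists_isLink_of_mem_edgeSet he
    by_cases hx : x ∈ C
    · have : {j | e ∈ M j ∪ N j} = {j | e ∈ M j} := by
        ext j
        exact ⟨fun h => h.resolve_right fun h' => hNi j e x h' hxy.inc_left hx, Or.inl⟩
      rw [this]
      exact hMk e (((hCi e x).2 ⟨hxy.inc_left, hx⟩).edge_mem)
    · have : {j | e ∈ M j ∪ N j} = {j | e ∈ N j} := by
        ext j
        exact ⟨fun h => h.resolve_left fun h' => hx (hMi j e x h' hxy.inc_left), Or.inr⟩
      rw [this]
      exact hNk e (((hDi e x).2 ⟨hxy.inc_left, hxy.left_mem, hx⟩).edge_mem)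

end Induce

/-- A spanning tree of `G` rooted at `root`, given by the parent `par v` and the edge `edge v` from
`v` to its parent, that avoids the edge `edge root` joining `root` and `mate`. -/
structure RootedTree (G : Graph α β) where
  root : α
  mate : α
  par : α → α
  edge : α → β
  depth : α → ℕ
  height : ℕ
  link_root : G.IsLink (edge root) root mate
  link : ∀ v ∈ V(G), v ≠ root → G.IsLink (edge v) v (par v)
  edge_ne : ∀ v ∈ V(G), v ≠ root → edge v ≠ edge root
  depth_eq : ∀ v ∈ V(G), v ≠ root → depth v = depth (par v) + 1
  depth_root : depth root = 0
  depth_le : ∀ v ∈ V(G), depth v ≤ height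

/-- Let `C` be the component of `v₀` after deletion of an edge `e₀` at `v₀`. If `e₀` left `C`, it
would be the whole cut of `C`; then `C` would be odd and its cut would need at least `r > 1` edges.
So `e₀` stays in `C`, and shortest paths avoiding `e₀` give the tree. -/
lemma IsRGraph.exists_rootedTree {G : Graph α β} {r : ℕ} (h : G.IsRGraph r) (hr : Odd r)
    (h1 : 1 < r) {v₀ : α} (hv₀ : v₀ ∈ V(G)) :
    ∃ C ⊆ V(G), v₀ ∈ C ∧ G.edgeBoundary C = ∅ ∧ Nonempty (RootedTree (G.induce C)) := by
  classical
  have hl := h.loopless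
  have hne : (G.incidenceSet v₀).Nonempty := by
    apply Set.nonempty_of_ncard_ne_zero
    have := h.regular v₀ hv₀
    unfold degree at this
    omega
  obtain ⟨e₀, z, hz⟩ := hne
  let K : SimpleGraph α :=
    { Adj := fun x y => ∃ e, e ≠ e₀ ∧ G.IsLink e x y
      symm := ⟨fun x y ⟨e, he, h⟩ => ⟨e, he, h.symm⟩⟩
      loopless := ⟨fun x ⟨e, _, h⟩ => h.ne rfl⟩ }
  let C : Set α := {x | K.Reachable x v₀}
  have hv₀C : v₀ ∈ C := SimpleGraph.Reachable.refl _
  have hCV : C ⊆ V(G) := by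
    rintro x ⟨p⟩
    cases p with
    | nil => exact hv₀
    | cons hadj _ => exact hadj.choose_spec.2.left_mem
  have hcl : ∀ e x y, e ≠ e₀ → G.IsLink e x y → x ∈ C → y ∈ C := by
    intro e x y he hxy hx
    exact SimpleGraph.Reachable.trans (SimpleGraph.Adj.reachable ⟨e, he, hxy.symm⟩) hx
  have hzC : z ∈ C := by
    by_contra hzC
    have hb : G.edgeBoundary C = {e₀} := by
      ext e
      constructor
      · rintro ⟨x, y, hxy, hx, hy⟩
        by_contra he
        exact hy (hcl e x y he hxy hx)
      · rintro rfl
        exact ⟨v₀, z, hz, hv₀C, hzC⟩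
    have hodd : Odd C.ncard := by
      rw [h.odd_ncard_iff hr hCV, hb]; simp
    have := h.le_boundary C hCV hodd
    rw [hb, ncard_singleton] at this
    omega
  have hb : G.edgeBoundary C = ∅ := by
    ext e
    simp only [mem_empty_iff_false, iff_false]
    rintro ⟨x, y, hxy, hx, hy⟩
    by_cases he : e = e₀
    · subst he
      rcases hxy.right_eq_or_eq hz with rfl | rfl
      exacts [hy hv₀C, hy hzC]
    · exact hy (hcl e x y he hxy hx)
  -- The parent of `v` is the second vertex of a shortest walk to `v₀`, so the distance drops by
  -- exactly one. Outside `C` and at `v₀` the value is arbitrary.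
  have hpar : ∀ v : α, ∃ p : β × α, v ∈ C → v ≠ v₀ →
      p.1 ≠ e₀ ∧ G.IsLink p.1 v p.2 ∧ p.2 ∈ C ∧ K.dist v v₀ = K.dist p.2 v₀ + 1 := by
    intro v
    by_cases hv : v ∈ C ∧ v ≠ v₀
    · obtain ⟨p, hp⟩ := SimpleGraph.Reachable.exists_walk_length_eq_dist hv.1
      cases p with
      | nil => exact absurd rfl hv.2
      | @cons _ w _ hadj q =>
        obtain ⟨e, he, hvw⟩ := hadj
        refine ⟨(e, w), fun _ _ => ⟨he, hvw, ⟨q⟩, ?_⟩⟩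
        have h1 := SimpleGraph.dist_le q
        have hadj : K.Adj v w := ⟨e, he, hvw⟩
        have h2 : K.dist v v₀ ≤ K.dist w v₀ + 1 := by
          obtain ⟨q', hq'⟩ := SimpleGraph.Reachable.exists_walk_length_eq_dist
            (⟨q⟩ : K.Reachable w v₀)
          have := SimpleGraph.dist_le (SimpleGraph.Walk.cons hadj q')
          simpa [hq'] using this
        simp only [SimpleGraph.Walk.length_cons] at hp
        dsimp only
        omega
    · exact ⟨(e₀, v₀), fun h1 h2 => absurd ⟨h1, h2⟩ hv⟩
  choose p hp using hpar
  obtain ⟨N, hN⟩ := ((h.finite_vertexSet.subset hCV).image fun v => K.dist v v₀).bddAbove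
  refine ⟨C, hCV, hv₀C, hb, ⟨{
    root := v₀
    mate := z
    par := fun v => (p v).2
    edge := fun v => if v = v₀ then e₀ else (p v).1
    depth := fun v => K.dist v v₀
    height := N
    link_root := by simpa using ⟨hz, hv₀C, hzC⟩
    link := fun v hv hne => by
      have := hp v hv hne
      simpa [hne] using ⟨this.2.1, hv, this.2.2.1⟩
    edge_ne := fun v hv hne => by simpa [hne] using (hp v hv hne).1
    depth_eq := fun v hv hne => (hp v hv hne).2.2.2
    depth_root := by simp
    depth_le := fun v hv => hN ⟨v, hv, rfl⟩ }⟩⟩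

end General

/-! ### Simple graphs given by a relation -/

section OfRel

variable {γ : Type*}

/-- The graph on `V` with an edge `s(x, y)` for any two vertices related by `A`. -/
def ofRel (V : Set γ) (A : γ → γ → Prop) : Graph γ (Sym2 γ) where
  vertexSet := V
  IsLink e x y := e = s(x, y) ∧ x ∈ V ∧ y ∈ V ∧ x ≠ y ∧ (A x y ∨ A y x)
  isLink_symm := by
    rintro e -
    exact ⟨fun x y ⟨he, hx, hy, hne, h⟩ => ⟨he.trans Sym2.eq_swap, hy, hx, hne.symm, h.symm⟩⟩
  eq_or_eq_of_isLink_of_isLink := by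
    rintro e x y v w ⟨rfl, _⟩ ⟨h, _⟩
    rw [Sym2.eq_iff] at h
    exact h.imp And.left And.left

variable {V : Set γ} {A B : γ → γ → Prop}

lemma ofRel_isLink {e : Sym2 γ} {x y : γ} : (ofRel V A).IsLink e x y ↔
    e = s(x, y) ∧ x ∈ V ∧ y ∈ V ∧ x ≠ y ∧ (A x y ∨ A y x) := Iff.rfl

lemma ofRel_adj {x y : γ} : (ofRel V A).Adj x y ↔
    x ∈ V ∧ y ∈ V ∧ x ≠ y ∧ (A x y ∨ A y x) :=
  ⟨fun ⟨_, h⟩ => h.2, fun h => ⟨_, rfl, h⟩⟩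

lemma isLink_ofRel_of_adj {x y : γ} (h : (ofRel V A).Adj x y) :
    (ofRel V A).IsLink s(x, y) x y := ⟨rfl, ofRel_adj.1 h⟩

lemma ofRel_isLink_iff {e : Sym2 γ} {x y : γ} : (ofRel V A).IsLink e x y ↔
    e = s(x, y) ∧ (ofRel V A).Adj x y := by rw [ofRel_isLink, ofRel_adj]

lemma simple_ofRel : (ofRel V A).Simple where
  not_isLoopAt _ _ h := h.2.2.2.1 rfl
  eq_of_isLink _ _ _ _ h h' := h.1.trans h'.1.symm

lemma degree_ofRel (x : γ) : (ofRel V A).degree x = {y | (ofRel V A).Adj x y}.ncard := by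
  unfold degree
  have : (ofRel V A).incidenceSet x = (fun y => s(x, y)) '' {y | (ofRel V A).Adj x y} := by
    ext e
    constructor
    · rintro ⟨y, hy⟩
      exact ⟨y, ⟨e, hy⟩, hy.1.symm⟩
    · rintro ⟨y, hy, rfl⟩
      exact ⟨y, isLink_ofRel_of_adj hy⟩
  rw [this, ncard_image_of_injective]
  exact fun y z h => Sym2.congr_right.1 h

lemma isAutomorphism_ofRel {σ : γ → γ} (hσ : BijOn σ V V)
    (hA : ∀ x y, A (σ x) (σ y) ↔ A x y) : (ofRel V A).IsAutomorphism σ where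
  bijOn := hσ
  multiplicity_eq x hx y hy := by
    have hm : ∀ x y, (ofRel V A).multiplicity x y = {e | e = s(x, y) ∧
        (ofRel V A).Adj x y}.ncard := by
      intro x y
      simp only [multiplicity, ofRel_isLink_iff]
    have hadj : (ofRel V A).Adj (σ x) (σ y) ↔ (ofRel V A).Adj x y := by
      rw [ofRel_adj, ofRel_adj, hA, hA, hσ.injOn.ne_iff hx hy]
      exact ⟨fun h => ⟨hx, hy, h.2.2⟩, fun h => ⟨hσ.mapsTo hx, hσ.mapsTo hy, h.2.2⟩⟩
    rw [hm, hm, hadj]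
    by_cases h : (ofRel V A).Adj x y <;> simp [h]

lemma ofRel_isSpanningSubgraph (h : ∀ x y, B x y → A x y) : ofRel V B ≤s ofRel V A where
  le := ⟨subset_rfl, fun _ _ _ ⟨h1, h2, h3, h4, h5⟩ => ⟨h1, h2, h3, h4, h5.imp (h _ _) (h _ _)⟩⟩
  vertexSet_eq := rfl

lemma finite_edgeSet_ofRel (hV : V.Finite) : E(ofRel V A).Finite := by
  refine ((hV.prod hV).image fun p => s(p.1, p.2)).subset ?_
  rintro e ⟨x, y, h⟩
  exact ⟨(x, y), ⟨h.2.1, h.2.2.1⟩, h.1.symm⟩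

/-- Edge-disjoint families of edges joining `S` to its complement bound the boundary of `S`. -/
lemma ncard_le_ncard_edgeBoundary {ι : Type*} (hV : V.Finite) {I : Set ι}
    {E : ι → γ → γ → Prop} {S : Set γ}
    (hA : ∀ i ∈ I, ∀ a b, E i a b → (ofRel V A).Adj a b)
    (hdisj : ∀ i ∈ I, ∀ j ∈ I, ∀ a b, E i a b → (E j a b ∨ E j b a) → i = j)
    (hI : ∀ i ∈ I, ∃ x ∈ S, ∃ y ∉ S, Relation.ReflTransGen (E i) x y) :
    I.ncard ≤ ((ofRel V A).edgeBoundary S).ncard := by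
  have key : ∀ i ∈ I, ∃ e, ∃ a b, e = s(a, b) ∧ a ∈ S ∧ b ∉ S ∧ E i a b := by
    intro i hi
    obtain ⟨x, hx, y, hy, h⟩ := hI i hi
    by_contra! hcon
    refine hy ?_
    clear hy
    induction h with
    | refl => exact hx
    | tail _ hbc ih => exact by_contra fun hc => hcon _ _ _ rfl ih hc hbc
  rcases I.eq_empty_or_nonempty with rfl | ⟨i₀, hi₀⟩
  · simp
  have : Nonempty (Sym2 γ) := ⟨(key i₀ hi₀).choose⟩
  choose! f hf using key
  refine ncard_le_ncard_of_injOn f (fun i hi => ?_) (fun i hi j hj hij => ?_)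
    ((finite_edgeSet_ofRel hV).subset fun e ⟨x, y, h, _⟩ => h.edge_mem)
  · obtain ⟨a, b, h, ha, hb, hE⟩ := hf i hi
    exact ⟨a, b, h ▸ isLink_ofRel_of_adj (hA i hi a b hE), ha, hb⟩
  · obtain ⟨a, b, h, ha, hb, hE⟩ := hf i hi
    obtain ⟨a', b', h', ha', hb', hE'⟩ := hf j hj
    rw [h, h', Sym2.eq_iff] at hij
    rcases hij with ⟨rfl, rfl⟩ | ⟨rfl, rfl⟩
    · exact hdisj i hi j hj _ _ hE (Or.inl hE')
    · exact hdisj i hi j hj _ _ hE (Or.inr hE')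

end OfRel

/-! ### Trees given by a parent map -/

section Tree

variable {γ : Type*} {V : Set γ} {P : γ → γ} {d : γ → ℕ} {x₀ : γ}

/-- The graph joining each vertex other than `x₀` to its parent. -/
def ofParent (V : Set γ) (P : γ → γ) (x₀ : γ) : Graph γ (Sym2 γ) :=
  ofRel V fun x y => x ≠ x₀ ∧ P x = y

lemma ofParent_adj_parent (hP : ∀ x ∈ V, x ≠ x₀ → P x ∈ V ∧ d x = d (P x) + 1) {x : γ}
    (hx : x ∈ V) (hne : x ≠ x₀) : (ofParent V P x₀).Adj x (P x) := by
  refine ofRel_adj.2 ⟨hx, (hP x hx hne).1, fun h => ?_, Or.inl ⟨hne, rfl⟩⟩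
  have := (hP x hx hne).2
  rw [← h] at this
  omega

lemma exists_walk_ofParent (hP : ∀ x ∈ V, x ≠ x₀ → P x ∈ V ∧ d x = d (P x) + 1)
    (hx₀ : x₀ ∈ V) (h0 : d x₀ = 0) (n : ℕ) : ∀ x (hx : x ∈ V), d x = n →
      ∃ p : (ofParent V P x₀).toSimpleGraph.Walk ⟨x, hx⟩ ⟨x₀, hx₀⟩, p.length = n := by
  induction n with
  | zero =>
    intro x hx hd
    have : x = x₀ := by
      by_contra hne
      have := (hP x hx hne).2
      omega
    subst this
    exact ⟨SimpleGraph.Walk.nil, rfl⟩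
  | succ n ih =>
    intro x hx hd
    have hne : x ≠ x₀ := by rintro rfl; omega
    obtain ⟨hPx, hPd⟩ := hP x hx hne
    obtain ⟨p, hp⟩ := ih (P x) hPx (by omega)
    have hadj := ofParent_adj_parent hP hx hne
    refine ⟨SimpleGraph.Walk.cons (v := ⟨P x, hPx⟩) ⟨fun h => ?_, hadj⟩ p,
      (SimpleGraph.Walk.length_cons _ _).trans (congrArg (· + 1) hp)⟩
    have : x = P x := congrArg Subtype.val h
    rw [← this] at hPd
    omega

/-- Each step of a walk changes `d` by exactly one. This is the lower bound for distances from `x₀`.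
-/
lemma le_add_length_of_walk_ofParent (hP : ∀ x ∈ V, x ≠ x₀ → P x ∈ V ∧ d x = d (P x) + 1)
    {a b : V(ofParent V P x₀)} (p : (ofParent V P x₀).toSimpleGraph.Walk a b) :
    d b ≤ d a + p.length := by
  induction p with
  | nil => simp
  | @cons a b c hadj q ih =>
    have h := ofRel_adj.1 hadj.2
    rw [SimpleGraph.Walk.length_cons]
    rcases h.2.2.2 with ⟨hne, hpar⟩ | ⟨hne, hpar⟩
    · have := (hP a h.1 hne).2
      rw [hpar] at this
      omega
    · have := (hP b h.2.1 hne).2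
      rw [hpar] at this
      omega

lemma dist_ofParent (hP : ∀ x ∈ V, x ≠ x₀ → P x ∈ V ∧ d x = d (P x) + 1)
    (hx₀ : x₀ ∈ V) (h0 : d x₀ = 0) (x : V(ofParent V P x₀)) :
    (ofParent V P x₀).toSimpleGraph.dist ⟨x₀, hx₀⟩ x = d x := by
  obtain ⟨p, hp⟩ := exists_walk_ofParent hP hx₀ h0 _ x.1 x.2 rfl
  apply le_antisymm
  · rw [SimpleGraph.dist_comm, ← hp]
    exact SimpleGraph.dist_le p
  · obtain ⟨q, hq⟩ := SimpleGraph.Reachable.exists_walk_length_eq_dist ⟨p.reverse⟩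
    rw [← hq]
    have := le_add_length_of_walk_ofParent hP q
    simpa [h0] using this

/-- A connected graph is a tree when it has one edge fewer than vertices, and every edge here is the
parent edge of some vertex other than `x₀`. -/
lemma isTree_ofParent (hV : V.Finite) (hP : ∀ x ∈ V, x ≠ x₀ → P x ∈ V ∧ d x = d (P x) + 1)
    (hx₀ : x₀ ∈ V) (h0 : d x₀ = 0) : (ofParent V P x₀).IsTree where
  simple := simple_ofRel
  isTree := by
    have hfin : Finite V(ofParent V P x₀) := hV.to_subtype
    set K := (ofParent V P x₀).toSimpleGraph
    have hconn : K.Connected := by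
      rw [SimpleGraph.connected_iff_exists_forall_reachable]
      refine ⟨⟨x₀, hx₀⟩, fun x => ?_⟩
      obtain ⟨p, _⟩ := exists_walk_ofParent hP hx₀ h0 _ x.1 x.2 rfl
      exact ⟨p.reverse⟩
    rw [SimpleGraph.isTree_iff_connected_and_card]
    refine ⟨hconn, le_antisymm ?_ hconn.card_vert_le_card_edgeSet_add_one⟩
    classical
    let f : V(ofParent V P x₀) → Sym2 V(ofParent V P x₀) := fun x =>
      if h : x.1 ≠ x₀ then s(x, ⟨P x, (hP x x.2 h).1⟩) else s(x, x)
    have hsub : K.edgeSet ⊆ f '' ({⟨x₀, hx₀⟩}ᶜ) := by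
      intro e
      induction e with | h a b => ?_
      intro he
      have hadj := (ofRel_adj.1 (SimpleGraph.mem_edgeSet K |>.1 he).2).2.2.2
      rcases hadj with ⟨hne, hpar⟩ | ⟨hne, hpar⟩
      · refine ⟨a, fun h => hne (congrArg Subtype.val h), ?_⟩
        simp only [f, hne, ne_eq, not_false_eq_true, dif_pos, hpar]
      · refine ⟨b, fun h => hne (congrArg Subtype.val h), ?_⟩
        simp only [f, hne, ne_eq, not_false_eq_true, dif_pos, hpar]
        exact Sym2.eq_swap
    have h1 : Nat.card K.edgeSet ≤ ({⟨x₀, hx₀⟩}ᶜ : Set V(ofParent V P x₀)).ncard := by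
      rw [Nat.card_coe_set_eq]
      exact (ncard_le_ncard hsub (toFinite _)).trans (ncard_image_le (toFinite _))
    have h2 := ncard_add_ncard_compl ({⟨x₀, hx₀⟩} : Set V(ofParent V P x₀))
    rw [ncard_singleton] at h2
    omega

end Tree

/-! ### Reduced words and the reflection of alternating segments -/

section Words

variable {r : ℕ}

/-- The arithmetic content of `r` being odd: a reflection `c ↦ 2 * d - c` fixes only `d`, and `d`
can be recovered from it or from a translation by `2 * d`. -/
lemma two_mul_zmod_injective (hr : Odd r) : Function.Injective fun a : ZMod r => 2 * a := by
  have h : IsUnit ((2 : ℕ) : ZMod r) :=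
    (ZMod.isUnit_iff_coprime 2 r).2 (Nat.coprime_two_left.2 hr)
  simpa using h.mul_right_injective

lemma two_mul_sub_ne (hr : Odd r) {c d : ZMod r} (h : d ≠ c) : 2 * d - c ≠ c := by
  intro h'
  exact h (two_mul_zmod_injective hr (by linear_combination h'))

/-- Words in the free product of `r` groups of order two, written from right to left, that are
reduced and begin with the letter `0`. -/
def IsWord : List (ZMod r) → Prop
  | [] => False
  | [c] => c = 0
  | c :: c' :: l => c ≠ c' ∧ IsWord (c' :: l)

/-- Replace `c` by `2 * d - c` in the longest final segment of a word in which
all consecutive letters are exchanged by this substitution. The value is `none` if this is the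
whole word. -/
def flip (d : ZMod r) : List (ZMod r) → Option (List (ZMod r))
  | [] => none
  | [_] => none
  | c :: c' :: l =>
    if c' = 2 * d - c then (flip d (c' :: l)).map (c' :: ·) else some ((2 * d - c) :: c' :: l)

/-- The word of length `n` beginning with `0` in which the letters `0` and `2 * d` alternate. -/
def altWord (d : ZMod r) : ℕ → List (ZMod r)
  | 0 => []
  | n + 1 => (if Even n then 0 else 2 * d) :: altWord d n

@[simp] lemma length_altWord (d : ZMod r) (n : ℕ) : (altWord d n).length = n := by
  induction n with
  | zero => rfl
  | succ n ih => simp [altWord, ih]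

lemma isWord_altWord (hr : Odd r) {d : ZMod r} (hd : d ≠ 0) (n : ℕ) :
    IsWord (altWord d (n + 1)) := by
  have h2 : 2 * d ≠ 0 := fun h => hd (two_mul_zmod_injective hr (by simpa using h))
  induction n with
  | zero => simp [altWord, IsWord]
  | succ n ih =>
    refine ⟨?_, ih⟩
    by_cases h : Even n
    · simpa [h, Nat.even_add_one] using h2
    · simpa [h, Nat.even_add_one] using h2.symm

lemma headD_altWord_ne {d : ZMod r} (hd : d ≠ 0) (n : ℕ) :
    d ≠ (altWord d n).headD 0 := by
  cases n with
  | zero => simpa [altWord] using hd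
  | succ n =>
    by_cases h : Even n
    · simpa [altWord, h] using hd
    · simp only [altWord, h, if_false, List.headD_cons]
      intro h'
      exact hd (by linear_combination -h')

lemma altWord_injective (hr : Odd r) {d d' : ZMod r} {n : ℕ}
    (h : altWord d (n + 2) = altWord d' (n + 2)) : d = d' := by
  induction n with
  | zero =>
    simp only [altWord] at h
    exact two_mul_zmod_injective hr (by simpa using h)
  | succ n ih =>
    rw [altWord, altWord] at h
    exact ih (List.cons.inj h).2

/-- The alternating segment reaches the first letter, which is `0`, precisely when all letters
alternate between `0` and its mirror image `2 * d`. -/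
lemma flip_eq_none_iff {d : ZMod r} {w : List (ZMod r)} (hw : IsWord w) :
    flip d w = none ↔ w = altWord d w.length := by
  induction w with
  | nil => exact hw.elim
  | cons c l ih =>
    cases l with
    | nil =>
      have : c = 0 := hw
      simp [flip, altWord, this]
    | cons c' l =>
      have ih := ih hw.2
      -- Once the tail alternates between `0` and `2 * d`, being the mirror image of the next letter
      -- is the same as being the letter prescribed by parity.
      have key : c' :: l = altWord d (l.length + 1) →
          (c' = 2 * d - c ↔ c = if Even (l.length + 1) then 0 else 2 * d) := by
        intro h
        have hc' : c' = if Even l.length then 0 else 2 * d := (List.cons.inj h).1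
        rw [hc']
        by_cases h : Even l.length
        · simp only [Nat.even_add_one, h, if_true, not_true, if_false]
          exact ⟨fun h => by linear_combination h, fun h => by linear_combination h⟩
        · simp only [Nat.even_add_one, h, if_false, not_false_eq_true, if_true]
          exact ⟨fun h => by linear_combination h, fun h => by linear_combination h⟩
      rw [flip, List.length_cons, altWord, List.cons_eq_cons]
      by_cases h : c' = 2 * d - c
      · rw [if_pos h, Option.map_eq_none_iff, ih]
        exact ⟨fun h' => ⟨(key h').1 h, h'⟩, fun h' => h'.2⟩
      · rw [if_neg h]
        simp only [reduceCtorEq, false_iff]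
        exact fun h' => h ((key h'.2).2 h'.1)

/-- At the end of the exchanged segment, the letter that follows differs from the last exchanged
letter because the word is reduced, and from its mirror image because the segment is maximal. The
exchange swaps these two conditions, so the new word is reduced with the same maximal segment, and
`flip d` is an involution. -/
lemma flip_eq_some {d : ZMod r} {w w' : List (ZMod r)} (hw : IsWord w)
    (hd : d ≠ w.headD 0) (h : flip d w = some w') :
    IsWord w' ∧ w'.length = w.length ∧ w'.headD 0 = 2 * d - w.headD 0 ∧ flip d w' = some w := by
  induction w generalizing w' with
  | nil => exact hw.elim
  | cons c l ih =>
    cases l with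
    | nil => simp [flip] at h
    | cons c' l =>
      obtain ⟨hcc, hw'⟩ := hw
      have hdc : d ≠ c := by simpa using hd
      rw [flip] at h
      by_cases hc : c' = 2 * d - c
      · rw [if_pos hc, Option.map_eq_some_iff] at h
        obtain ⟨u, hu, rfl⟩ := h
        have hdc' : d ≠ c' := by
          intro h
          exact hdc (by linear_combination -hc - h)
        obtain ⟨h1, h2, h3, h4⟩ := ih hw' (by simpa using hdc') hu
        cases u with
        | nil => exact h1.elim
        | cons b u =>
          have hb : b = c := by
            have : b = 2 * d - c' := by simpa using h3
            rw [this, hc]; ring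
          subst hb
          refine ⟨⟨hcc.symm, h1⟩, by simpa using h2, by simpa using hc, ?_⟩
          rw [flip, if_pos (by rw [hc]; ring), h4]
          rfl
      · rw [if_neg hc] at h
        obtain rfl := Option.some.inj h
        refine ⟨⟨fun h => hc h.symm, hw'⟩, rfl, rfl, ?_⟩
        have h5 : 2 * d - (2 * d - c) = c := by ring
        rw [flip, h5, if_neg (fun h => hcc h.symm)]

lemma finite_setOf_isWord [NeZero r] (n : ℕ) :
    {w : List (ZMod r) | IsWord w ∧ w.length ≤ n}.Finite :=
  (List.finite_length_le (ZMod r) n).subset fun _ h => h.2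

end Words

/-! ### Vertices of the rotation graph and the colored edges at words -/

/-- The vertices of the rotation graph built from a rooted graph: a root, `r` copies of the old
vertices, and words attached to the ends of old edges in each copy. -/
inductive RotVert (r : ℕ) (α β : Type*)
  | top : RotVert r α β
  | old (j : ZMod r) (v : α) : RotVert r α β
  | word (j : ZMod r) (v : α) (e : β) (w : List (ZMod r)) : RotVert r α β

namespace RootedTree

variable {α β : Type*} {G : Graph α β} (D : RootedTree G) {r : ℕ}

/-- The edge at the root that is not in the tree. -/
abbrev rootEdge : β := D.edge D.root

/-- The edges of the tree. -/
def IsTreeEdge (e : β) : Prop := ∃ v ∈ V(G), v ≠ D.root ∧ D.edge v = e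

/-- The ends of the edges outside of the tree, except for the end of `rootEdge` at the root. -/
structure IsHalf (e : β) (v : α) : Prop where
  inc : G.Inc e v
  not_isTreeEdge : ¬ D.IsTreeEdge e
  ne_root : e = D.rootEdge → v ≠ D.root

/-- The length of the longest words attached to an end of an edge at `v`. -/
def len (v : α) : ℕ := D.height + 2 - D.depth v

open Classical in
/-- The other end of an edge. -/
noncomputable def other (_ : RootedTree G) (e : β) (v : α) : α :=
  if h : G.Inc e v then h.choose else v

lemma isLink_other {e : β} {v : α} (h : G.Inc e v) : G.IsLink e v (D.other e v) := by
  rw [other, dif_pos h]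
  exact h.choose_spec

lemma other_other {e : β} {v : α} (h : G.Inc e v) : D.other e (D.other e v) = v :=
  (D.isLink_other (D.isLink_other h).inc_right).right_unique (D.isLink_other h).symm

/-- Length at least two keeps `[0]` from being a leaf and lets the second letter `2 * d` of `altWord
d (D.len v)` determine `d`. -/
lemma two_le_len {v : α} (hv : v ∈ V(G)) : 2 ≤ D.len v := by
  have := D.depth_le v hv
  unfold len
  omega

lemma root_mem : D.root ∈ V(G) := D.link_root.left_mem

lemma par_mem {v : α} (hv : v ∈ V(G)) (hne : v ≠ D.root) : D.par v ∈ V(G) :=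
  (D.link v hv hne).right_mem

/-- Two vertices sharing a tree edge would be parents of each other, against the growth of `depth`;
`rootEdge` is no tree edge. -/
lemma edge_injOn : InjOn D.edge V(G) := by
  intro v hv w hw h
  by_cases h1 : v = D.root
  · by_cases h2 : w = D.root
    · rw [h1, h2]
    · exact absurd (h1 ▸ h).symm (D.edge_ne w hw h2)
  · by_cases h2 : w = D.root
    · exact absurd (h2 ▸ h) (D.edge_ne v hv h1)
    · have hl := D.link v hv h1
      rw [h] at hl
      rcases hl.eq_and_eq_or_eq_and_eq (D.link w hw h2) with h3 | ⟨h3, h4⟩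
      · exact h3.1
      · have h5 := D.depth_eq v hv h1
        have h6 := D.depth_eq w hw h2
        rw [h4] at h5
        rw [← h3] at h6
        omega

lemma not_isTreeEdge_rootEdge : ¬ D.IsTreeEdge D.rootEdge := fun ⟨v, hv, h, h'⟩ =>
  D.edge_ne v hv h h'

variable {D}

lemma IsHalf.vertex_mem {e : β} {v : α} (h : D.IsHalf e v) : v ∈ V(G) := h.inc.vertex_mem

lemma IsHalf.eq_mate {v : α} (h : D.IsHalf D.rootEdge v) : v = D.mate :=
  (h.inc.eq_or_eq_of_isLink D.link_root).resolve_left (h.ne_root rfl)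

lemma isHalf_mate (hG : G.Loopless) : D.IsHalf D.rootEdge D.mate where
  inc := D.link_root.inc_right
  not_isTreeEdge := D.not_isTreeEdge_rootEdge
  ne_root _ := D.link_root.ne.symm

lemma IsHalf.other {e : β} {v : α} (h : D.IsHalf e v) (he : e ≠ D.rootEdge) :
    D.IsHalf e (D.other e v) where
  inc := (D.isLink_other h.inc).inc_right
  not_isTreeEdge := h.not_isTreeEdge
  ne_root h' := absurd h' he

variable (D)

open RotVert

/-- The vertices that occur in the rotation graph. -/
def verts : Set (RotVert r α β)
  | top => True
  | old _ v => v ∈ V(G)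
  | word _ v e w => D.IsHalf e v ∧ IsWord w ∧ w.length ≤ D.len v

open Classical in
/-- The parent in the spanning tree of the rotation graph. -/
noncomputable def parent : RotVert r α β → RotVert r α β
  | top => top
  | old j v => if v = D.root then top else old j (D.par v)
  | word j v e (_ :: c :: l) => word j v e (c :: l)
  | word j v _ _ => old j v

/-- The distance from the root in the spanning tree of the rotation graph. -/
def level : RotVert r α β → ℕ
  | top => 0
  | old _ v => D.depth v + 1
  | word _ v _ w => D.depth v + 1 + w.length

open Classical in
/-- The neighbor of the vertex `word j v e w` along the edge of color `d`. -/
noncomputable def nbr (j : ZMod r) (v : α) (e : β) (w : List (ZMod r)) (d : ZMod r) :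
    RotVert r α β :=
  if d = w.headD 0 then D.parent (word j v e w)
  else if w.length < D.len v then word j v e (d :: w)
  else match flip d w with
    | some w' => word j v e w'
    | none =>
      if e = D.rootEdge then word (j + 2 * d) v e (altWord (-d) (D.len v))
      else word j (D.other e v) e (altWord d (D.len (D.other e v)))

@[simp] lemma top_mem_verts : (top : RotVert r α β) ∈ D.verts := trivial

@[simp] lemma old_mem_verts {j : ZMod r} {v : α} :
    (old j v : RotVert r α β) ∈ D.verts ↔ v ∈ V(G) := Iff.rfl

lemma parent_mem {x : RotVert r α β} (hx : x ∈ D.verts) (hne : x ≠ top) :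
    D.parent x ∈ D.verts ∧ D.level x = D.level (D.parent x) + 1 := by
  cases x with
  | top => exact absurd rfl hne
  | old j v =>
    by_cases hv : v = D.root
    · simp [parent, hv, level, D.depth_root]
    · simpa [parent, hv, level] using ⟨D.par_mem hx hv, D.depth_eq v hx hv⟩
  | word j v e w =>
    obtain ⟨h1, h2, h3⟩ := hx
    match w with
    | [] => exact h2.elim
    | [c] => exact ⟨h1.vertex_mem, rfl⟩
    | c :: c' :: l =>
      refine ⟨⟨h1, h2.2, ?_⟩, rfl⟩
      simp only [List.length_cons] at h3 ⊢
      omega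

section nbr

variable {D} {j : ZMod r} {v : α} {e : β} {w : List (ZMod r)} {d : ZMod r}

lemma nbr_headD : D.nbr j v e w (w.headD 0) = D.parent (word j v e w) := if_pos rfl

lemma nbr_zero : D.nbr j v e [0] 0 = old j v := nbr_headD

lemma nbr_of_length_lt (hd : d ≠ w.headD 0) (h : w.length < D.len v) :
    D.nbr j v e w d = word j v e (d :: w) := by
  rw [nbr, if_neg hd, if_pos h]

lemma nbr_of_flip_eq_some {w' : List (ZMod r)} (hd : d ≠ w.headD 0) (h : w.length = D.len v)
    (hf : flip d w = some w') : D.nbr j v e w d = word j v e w' := by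
  rw [nbr, if_neg hd, if_neg h.not_lt, hf]

lemma isWord_altWord_len (hv : v ∈ V(G)) (hr : Odd r) (hd : d ≠ 0) :
    IsWord (altWord d (D.len v)) := by
  obtain ⟨n, hn⟩ := Nat.exists_eq_add_of_le' (D.two_le_len hv)
  rw [hn]
  exact isWord_altWord hr hd (n + 1)

/-- The color changes from `d` to `-d` while the copy changes from `j` to `j + 2 * d`. So the same
rule leads back, and copy plus color is the same at both ends; this sum is the color used for
`rootMatch`. -/
lemma nbr_altWord_rootEdge (hv : v ∈ V(G)) (hr : Odd r) (hd : d ≠ 0) :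
    D.nbr j v D.rootEdge (altWord d (D.len v)) d =
      word (j + 2 * d) v D.rootEdge (altWord (-d) (D.len v)) := by
  have hw : IsWord (altWord d (D.len v)) := isWord_altWord_len hv hr hd
  have hf : flip d (altWord d (D.len v)) = none := by
    rw [flip_eq_none_iff hw, length_altWord]
  rw [nbr, if_neg (headD_altWord_ne hd _), if_neg (by simp), hf]
  simp

lemma nbr_altWord (hv : v ∈ V(G)) (hr : Odd r) (hd : d ≠ 0) (he : e ≠ D.rootEdge) :
    D.nbr j v e (altWord d (D.len v)) d =
      word j (D.other e v) e (altWord d (D.len (D.other e v))) := by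
  have hw : IsWord (altWord d (D.len v)) := isWord_altWord_len hv hr hd
  have hf : flip d (altWord d (D.len v)) = none := by
    rw [flip_eq_none_iff hw, length_altWord]
  rw [nbr, if_neg (headD_altWord_ne hd _), if_neg (by simp), hf]
  simp [he]

variable (D d) in
-- The six kinds of edges at a word: to the old vertex, to the parent word, to a child, to a
-- reflected leaf, to another copy across `rootEdge`, and to the other end of an old edge.
lemma nbr_cases (hx : (word j v e w : RotVert r α β) ∈ D.verts) :
    (w = [0] ∧ d = 0 ∧ D.nbr j v e w d = old j v) ∨
    (∃ c l, w = d :: c :: l ∧ D.nbr j v e w d = word j v e (c :: l)) ∨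
    (d ≠ w.headD 0 ∧ w.length < D.len v ∧ D.nbr j v e w d = word j v e (d :: w)) ∨
    (d ≠ w.headD 0 ∧ w.length = D.len v ∧ ∃ w', flip d w = some w' ∧
      D.nbr j v e w d = word j v e w') ∨
    (d ≠ 0 ∧ w = altWord d (D.len v) ∧ e = D.rootEdge ∧
      D.nbr j v e w d = word (j + 2 * d) v e (altWord (-d) (D.len v))) ∨
    (d ≠ 0 ∧ w = altWord d (D.len v) ∧ e ≠ D.rootEdge ∧
      D.nbr j v e w d = word j (D.other e v) e (altWord d (D.len (D.other e v)))) := by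
  obtain ⟨h1, h2, h3⟩ := hx
  by_cases hd : d = w.headD 0
  · subst hd
    rw [nbr_headD]
    match w with
    | [] => exact h2.elim
    | [c] =>
      obtain rfl : c = 0 := h2
      exact Or.inl ⟨rfl, rfl, rfl⟩
    | c :: c' :: l => exact Or.inr (Or.inl ⟨c', l, rfl, rfl⟩)
  obtain hl | hl := h3.lt_or_eq
  · exact Or.inr (Or.inr (Or.inl ⟨hd, hl, nbr_of_length_lt hd hl⟩))
  cases hf : flip d w with
  | some w' => exact Or.inr (Or.inr (Or.inr (Or.inl ⟨hd, hl, w', rfl, nbr_of_flip_eq_some hd hl hf⟩)))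
  | none =>
    have hw := (flip_eq_none_iff h2).1 hf
    rw [hl] at hw
    -- For `d = 0` the alternating word repeats the letter `0` and is not reduced.
    have hd0 : d ≠ 0 := by
      rintro rfl
      obtain ⟨n, hn⟩ := Nat.exists_eq_add_of_le' (D.two_le_len h1.vertex_mem)
      rw [hw, hn] at h2
      exact h2.1 (by simp)
    refine Or.inr (Or.inr (Or.inr (Or.inr ?_)))
    by_cases he : e = D.rootEdge
    · exact Or.inl ⟨hd0, hw, he, by rw [nbr, if_neg hd, if_neg hl.not_lt, hf]; simp [he]⟩
    · exact Or.inr ⟨hd0, hw, he, by rw [nbr, if_neg hd, if_neg hl.not_lt, hf]; simp [he]⟩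

/-- Following an edge between words back. -/
lemma exists_nbr_eq (hr : Odd r) (hx : (word j v e w : RotVert r α β) ∈ D.verts)
    (h0 : ¬ (w = [0] ∧ d = 0)) :
    ∃ j' v' w' d', D.nbr j v e w d = word j' v' e w' ∧
      (word j' v' e w' : RotVert r α β) ∈ D.verts ∧ D.nbr j' v' e w' d' = word j v e w ∧
      ¬ (w' = [0] ∧ d' = 0) ∧ j' + d' = j + d ∧ (e ≠ D.rootEdge → j' = j) := by
  have hx' := hx
  obtain ⟨h1, h2, h3⟩ := hx
  rcases nbr_cases D d hx' with ⟨h, h', _⟩ | ⟨c, l, rfl, h⟩ | ⟨hd, hl, h⟩ |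
    ⟨hd, hl, w', hf, h⟩ | ⟨hd, rfl, rfl, h⟩ | ⟨hd, rfl, he, h⟩
  · exact absurd ⟨h, h'⟩ h0
  · have hlt : (c :: l).length < D.len v := by simp only [List.length_cons] at h3 ⊢; omega
    exact ⟨j, v, c :: l, d, h, ⟨h1, h2.2, hlt.le⟩, nbr_of_length_lt h2.1 hlt,
      fun h' => h2.1 (by rw [h'.2, (List.cons.inj h'.1).1]), rfl, fun _ => rfl⟩
  · obtain ⟨c, l, rfl⟩ : ∃ c l, w = c :: l := by
      cases w with
      | nil => exact h2.elim
      | cons c l => exact ⟨c, l, rfl⟩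
    exact ⟨j, v, d :: c :: l, d, h, ⟨h1, ⟨hd, h2⟩, hl⟩, nbr_headD, by simp, rfl, fun _ => rfl⟩
  · obtain ⟨h4, h5, h6, h7⟩ := flip_eq_some h2 hd hf
    have hd' : d ≠ w'.headD 0 := by
      rw [h6]
      exact fun h => hd (by linear_combination -h)
    refine ⟨j, v, w', d, h, ⟨h1, h4, (h5.trans hl).le⟩,
      nbr_of_flip_eq_some hd' (h5.trans hl) h7, ?_, rfl, fun _ => rfl⟩
    rintro ⟨rfl, rfl⟩
    exact hd' rfl
  · have hw := isWord_altWord_len (D := D) h1.vertex_mem hr (neg_ne_zero.2 hd)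
    refine ⟨_, _, _, -d, h, ⟨h1, hw, by simp⟩, ?_, fun h => hd (neg_eq_zero.1 h.2), by ring,
      fun h => absurd rfl h⟩
    rw [nbr_altWord_rootEdge h1.vertex_mem hr (neg_ne_zero.2 hd), neg_neg]
    congr 1
    ring
  · have h1' := h1.other he
    have hw := isWord_altWord_len (D := D) h1'.vertex_mem hr hd
    refine ⟨_, _, _, d, h, ⟨h1', hw, by simp⟩, ?_, fun h => hd h.2, rfl, fun _ => rfl⟩
    rw [nbr_altWord h1'.vertex_mem hr hd he, D.other_other h1.inc]

lemma nbr_mem (hr : Odd r) (hx : (word j v e w : RotVert r α β) ∈ D.verts) :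
    D.nbr j v e w d ∈ D.verts := by
  by_cases h0 : w = [0] ∧ d = 0
  · obtain ⟨rfl, rfl⟩ := h0
    rw [nbr_zero]
    exact hx.1.vertex_mem
  · obtain ⟨_, _, _, _, h1, h2, _⟩ := exists_nbr_eq hr hx h0
    rwa [h1]

lemma nbr_ne (hG : G.Loopless) (hr : Odd r)
    (hx : (word j v e w : RotVert r α β) ∈ D.verts) : D.nbr j v e w d ≠ word j v e w := by
  rcases nbr_cases D d hx with ⟨_, _, h⟩ | ⟨c, l, rfl, h⟩ | ⟨hd, hl, h⟩ |
    ⟨hd, hl, w', hf, h⟩ | ⟨hd, rfl, rfl, h⟩ | ⟨hd, rfl, he, h⟩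
  · simp [h]
  · rw [h]
    intro h'
    simp at h'
  · simp [h]
  · rw [h]
    have := (flip_eq_some hx.2.1 hd hf).2.2.1
    intro h'
    obtain rfl : w' = w := by injection h'
    exact two_mul_sub_ne hr hd this.symm
  · rw [h]
    intro h'
    have : j + 2 * d = j := by injection h'
    exact hd (two_mul_zmod_injective hr (by simpa using this))
  · rw [h]
    intro h'
    have : D.other e v = v := by injection h'
    exact (D.isLink_other hx.1.inc).ne this.symm

/-- The neighbor reveals the kind of edge by its length, its copy and its old vertex. Within one
kind, the color is read off from the removed or added letter, from the reflected head `2 * d - c`,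
from the translation `2 * d` of the copy, or from the second letter of the alternating word. -/
lemma nbr_injective (hG : G.Loopless) (hr : Odd r)
    (hx : (word j v e w : RotVert r α β) ∈ D.verts) : Function.Injective (D.nbr j v e w) := by
  intro d d' hdd
  have hlo := D.isLink_other hx.1.inc
  have hne : D.other e v ≠ v := hlo.ne.symm
  have h2z : ∀ a : ZMod r, j + 2 * a = j → a = 0 := fun a h =>
    two_mul_zmod_injective hr (by simpa using h)
  have hl2 := D.two_le_len hx.1.vertex_mem
  rcases nbr_cases D d hx with ⟨hw, hd0, h⟩ | ⟨c, l, hw, h⟩ | ⟨hd, hl, h⟩ |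
    ⟨hd, hl, u, hf, h⟩ | ⟨hd, hw, he, h⟩ | ⟨hd, hw, he, h⟩ <;>
  rcases nbr_cases D d' hx with ⟨hw', hd0', h'⟩ | ⟨c', l', hw', h'⟩ | ⟨hd', hl', h'⟩ |
    ⟨hd', hl', u', hf', h'⟩ | ⟨hd', hw', he', h'⟩ | ⟨hd', hw', he', h'⟩ <;>
  rw [h, h'] at hdd <;> clear h h' <;>
  simp only [reduceCtorEq, word.injEq, true_and, and_true, List.cons.injEq] at hdd
  case inl.inl => rw [hd0, hd0']
  case inr.inl.inr.inl => rw [hw] at hw'; exact (List.cons.inj hw').1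
  case inr.inr.inl.inr.inr.inl => exact hdd
  case inr.inr.inr.inl.inr.inr.inr.inl =>
    have h1 := (flip_eq_some hx.2.1 hd hf).2.2.1
    have h2 := (flip_eq_some hx.2.1 hd' hf').2.2.1
    rw [hdd, h2] at h1
    exact two_mul_zmod_injective hr (by linear_combination -h1)
  case inr.inr.inr.inr.inl.inr.inr.inr.inr.inl =>
    exact two_mul_zmod_injective hr (by linear_combination hdd.1)
  case inr.inr.inr.inr.inr.inr.inr.inr.inr.inr =>
    obtain ⟨n, hn⟩ := Nat.exists_eq_add_of_le' hl2
    rw [hn] at hw hw'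
    exact altWord_injective hr (hw.symm.trans hw')
  all_goals exfalso
  all_goals first
    | exact hdd
    | exact hd (h2z _ hdd.1)
    | exact hd' (h2z _ hdd.1.symm)
    | exact hne hdd.1
    | exact hne hdd.1.symm
    | exact he he'
    | exact he' he
    | omega
    | skip
  case inr.inl.inr.inr.inl =>
    have := congrArg List.length hdd.2
    simp only [hw, List.length_cons] at this
    omega
  case inr.inr.inl.inr.inl =>
    have := congrArg List.length hdd.2
    simp only [hw', List.length_cons] at this
    omega
  case inr.inl.inr.inr.inr.inl =>
    have := (flip_eq_some hx.2.1 hd' hf').2.1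
    rw [← hdd, hw] at this
    simp at this
  case inr.inr.inr.inl.inr.inl =>
    have := (flip_eq_some hx.2.1 hd hf).2.1
    rw [hdd, hw'] at this
    simp at this

end nbr

end RootedTree

/-! ### Adjacency, degrees and the balanced spanning tree -/

namespace RootedTree

open RotVert

variable {α β : Type*} {G : Graph α β} (D : RootedTree G) {r : ℕ}

open Classical in
/-- The neighbor of `old j v` along the edge that replaces the old edge `e`. -/
noncomputable def oldNbr (j : ZMod r) (v : α) (e : β) : RotVert r α β :=
  if e = D.edge v then D.parent (old j v)
  else if D.IsTreeEdge e then old j (D.other e v)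
  else word j v e [0]

section oldNbr

variable {D} {j : ZMod r} {v : α} {e : β}

lemma oldNbr_rootEdge : D.oldNbr j D.root D.rootEdge = top := by simp [oldNbr, parent]

lemma oldNbr_edge (hv : v ≠ D.root) : D.oldNbr j v (D.edge v) = old j (D.par v) := by
  simp [oldNbr, parent, hv]

lemma oldNbr_edge_par (hv : v ∈ V(G)) (hne : v ≠ D.root) :
    D.oldNbr j (D.par v) (D.edge v) = old j v := by
  have hl := D.link v hv hne
  have h1 : D.edge v ≠ D.edge (D.par v) := fun h => by
    have h2 := D.edge_injOn hv (D.par_mem hv hne) h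
    have h3 := D.depth_eq v hv hne
    rw [← h2] at h3
    omega
  have h2 : D.IsTreeEdge (D.edge v) := ⟨v, hv, hne, rfl⟩
  rw [oldNbr, if_neg h1, if_pos h2]
  congr 1
  exact (D.isLink_other hl.inc_right).right_unique hl.symm

lemma IsHalf.ne_edge (h : D.IsHalf e v) : e ≠ D.edge v := by
  rintro rfl
  by_cases hv : v = D.root
  · subst hv
    exact h.ne_root rfl rfl
  · exact h.not_isTreeEdge ⟨v, h.vertex_mem, hv, rfl⟩

lemma IsHalf.oldNbr (h : D.IsHalf e v) : D.oldNbr j v e = word j v e [0] := by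
  rw [RootedTree.oldNbr, if_neg h.ne_edge, if_neg h.not_isTreeEdge]

/-- At the root, `rootEdge` acts as the parent edge. All other incidences are with parent edges,
with edges to children, or with non-tree edges, whose ends carry words. -/
lemma inc_cases (h : G.Inc e v) : (v = D.root ∧ e = D.rootEdge) ∨
    (v ≠ D.root ∧ e = D.edge v) ∨
    (∃ w ∈ V(G), w ≠ D.root ∧ v = D.par w ∧ e = D.edge w) ∨ D.IsHalf e v := by
  by_cases he : D.IsTreeEdge e
  · obtain ⟨w, hw, hne, rfl⟩ := he
    rcases h.eq_or_eq_of_isLink (D.link w hw hne) with rfl | rfl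
    · exact Or.inr (Or.inl ⟨hne, rfl⟩)
    · exact Or.inr (Or.inr (Or.inl ⟨w, hw, hne, rfl, rfl⟩))
  · by_cases hv : v = D.root ∧ e = D.rootEdge
    · exact Or.inl hv
    · exact Or.inr (Or.inr (Or.inr ⟨h, he, fun h h' => hv ⟨h', h⟩⟩))

/-- Parallel edges of `G` get separated: at most one of them is a tree edge, and each of the others
has its own word at `v`. Thus `old j v` keeps the degree of `v`. -/
lemma oldNbr_injOn : InjOn (D.oldNbr j v) (G.incidenceSet v) := by
  intro e he f hf h
  have hd := D.depth_eq
  rcases inc_cases (D := D) he with ⟨hv, rfl⟩ | ⟨hv, rfl⟩ | ⟨w, hw, hne, hv, rfl⟩ | hh <;>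
  rcases inc_cases (D := D) hf with ⟨hv', rfl⟩ | ⟨hv', rfl⟩ | ⟨w', hw', hne', hv', rfl⟩ | hh'
  case inl.inl => rfl
  case inr.inl.inr.inl => rfl
  case inr.inr.inr.inr.inr.inr =>
    rw [hh.oldNbr, hh'.oldNbr] at h
    injection h
  case inr.inr.inl.inr.inr.inl =>
    rw [hv, oldNbr_edge_par hw hne, ← hv, hv', oldNbr_edge_par hw' hne'] at h
    injection h with _ h
    rw [h]
  all_goals exfalso
  case inl.inr.inl => exact hv' hv
  case inr.inl.inl => exact hv hv'
  case inl.inr.inr.inl =>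
    rw [hv, oldNbr_rootEdge, ← hv, hv', oldNbr_edge_par hw' hne'] at h
    simp at h
  case inr.inr.inl.inl =>
    rw [hv', oldNbr_rootEdge, ← hv', hv, oldNbr_edge_par hw hne] at h
    simp at h
  case inl.inr.inr.inr =>
    rw [hv, oldNbr_rootEdge, ← hv, hh'.oldNbr] at h
    simp at h
  case inr.inr.inr.inl =>
    rw [hv', oldNbr_rootEdge, ← hv', hh.oldNbr] at h
    simp at h
  case inr.inl.inr.inr.inl =>
    rw [oldNbr_edge hv, hv', oldNbr_edge_par hw' hne', ← hv'] at h
    have h : D.par v = w' := by injection h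
    have h1 := hd v he.vertex_mem hv
    have h2 := hd w' hw' hne'
    rw [h] at h1
    rw [← hv'] at h2
    omega
  case inr.inr.inl.inr.inl =>
    rw [oldNbr_edge hv', hv, oldNbr_edge_par hw hne, ← hv] at h
    have h : w = D.par v := by injection h
    have h1 := hd v he.vertex_mem hv'
    have h2 := hd w hw hne
    rw [← h] at h1
    rw [← hv] at h2
    omega
  case inr.inl.inr.inr.inr =>
    rw [oldNbr_edge hv, hh'.oldNbr] at h
    simp at h
  case inr.inr.inr.inr.inl =>
    rw [oldNbr_edge hv', hh.oldNbr] at h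
    simp at h
  case inr.inr.inl.inr.inr.inr =>
    rw [hv, oldNbr_edge_par hw hne, ← hv, hh'.oldNbr] at h
    simp at h
  case inr.inr.inr.inr.inr.inl =>
    rw [hv', oldNbr_edge_par hw' hne', ← hv', hh.oldNbr] at h
    simp at h

end oldNbr

/-- The relation generating the adjacency of the rotation graph. -/
def rel (x y : RotVert r α β) : Prop :=
  (x ≠ top ∧ D.parent x = y) ∨ ∃ j v e w d, x = word j v e w ∧ D.nbr j v e w d = y

variable (r) in
/-- The rotation graph. -/
def rotGraph : Graph (RotVert r α β) (Sym2 (RotVert r α β)) := ofRel D.verts D.rel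

variable (r) in
/-- The spanning tree of the rotation graph. -/
noncomputable def rotTree : Graph (RotVert r α β) (Sym2 (RotVert r α β)) :=
  ofParent D.verts D.parent top

variable {D}

lemma rotTree_adj_parent {x : RotVert r α β} (hx : x ∈ D.verts) (hne : x ≠ top) :
    (D.rotTree r).Adj x (D.parent x) :=
  ofParent_adj_parent (d := D.level) (fun _ => D.parent_mem) hx hne

lemma rotTree_isSpanningSubgraph : D.rotTree r ≤s D.rotGraph r :=
  ofRel_isSpanningSubgraph fun _ _ h => Or.inl h

lemma rotGraph_adj_parent {x : RotVert r α β} (hx : x ∈ D.verts) (hne : x ≠ top) :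
    (D.rotGraph r).Adj x (D.parent x) :=
  (rotTree_adj_parent hx hne).mono rotTree_isSpanningSubgraph.le

/-- The relation `rel` is not visibly symmetric. Edges arriving at a word are reversed by
`exists_nbr_eq`, or come from a child and are recovered from its head letter. -/
lemma rotGraph_adj_word_iff (hG : G.Loopless) (hr : Odd r) {j : ZMod r} {v : α} {e : β}
    {w : List (ZMod r)} (hx : (word j v e w : RotVert r α β) ∈ D.verts) {y : RotVert r α β} :
    (D.rotGraph r).Adj (word j v e w) y ↔ ∃ d, D.nbr j v e w d = y := by
  rw [rotGraph, ofRel_adj]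
  constructor
  · rintro ⟨-, hy, -, (⟨-, h⟩ | ⟨j', v', e', w', d, h, h'⟩) | ⟨hne, h⟩ | ⟨j', v', e', w', d, rfl, h'⟩⟩
    · exact ⟨_, nbr_headD.trans h⟩
    · simp only [word.injEq] at h
      obtain ⟨rfl, rfl, rfl, rfl⟩ := h
      exact ⟨d, h'⟩
    · match y with
      | top => exact absurd rfl hne
      | old j' v' =>
        by_cases hv : v' = D.root <;> simp [parent, hv] at h
      | word j' v' e' [] => exact hy.2.1.elim
      | word j' v' e' [c] => simp [parent] at h
      | word j' v' e' (c :: c' :: l) =>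
        simp only [parent, word.injEq] at h
        obtain ⟨rfl, rfl, rfl, rfl⟩ := h
        exact ⟨c, nbr_of_length_lt hy.2.1.1 hy.2.2⟩
    · by_cases h0 : w' = [0] ∧ d = 0
      · obtain ⟨rfl, rfl⟩ := h0
        rw [nbr_zero] at h'
        simp at h'
      · obtain ⟨j₁, v₁, w₁, d₁, h1, _, h3, _⟩ := exists_nbr_eq hr hy h0
        rw [h'] at h1
        simp only [word.injEq] at h1
        obtain ⟨rfl, rfl, rfl, rfl⟩ := h1
        exact ⟨_, h3⟩
  · rintro ⟨d, rfl⟩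
    exact ⟨hx, nbr_mem hr hx, (nbr_ne hG hr hx).symm, Or.inl (Or.inr ⟨_, _, _, _, _, rfl, rfl⟩)⟩

variable (D) in
/-- The leaves of the spanning tree. -/
def IsLeaf : RotVert r α β → Prop
  | word _ v _ w => w.length = D.len v
  | _ => False

/-- Only reflections and crossings lie outside the tree, and both join words of full length. Hence
vertices that are not leaves have the same degree in the tree as in the graph. -/
lemma rotTree_adj_or_isLeaf {x y : RotVert r α β} (h : (D.rotGraph r).Adj x y) :
    (D.rotTree r).Adj x y ∨ D.IsLeaf x ∧ D.IsLeaf y := by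
  obtain ⟨hx, hy, hne, hrel⟩ := ofRel_adj.1 h
  wlog hxy : D.rel x y generalizing x y
  · exact (this h.symm hy hx hne.symm hrel.symm (hrel.resolve_left hxy)).imp Adj.symm And.symm
  rcases hxy with ⟨hne', rfl⟩ | ⟨j, v, e, w, d, rfl, rfl⟩
  · exact Or.inl (rotTree_adj_parent hx hne')
  rcases nbr_cases D d hx with ⟨rfl, rfl, h⟩ | ⟨c, l, rfl, h⟩ | ⟨hd, hl, h⟩ |
    ⟨hd, hl, w', hf, h⟩ | ⟨hd, rfl, rfl, h⟩ | ⟨hd, rfl, he, h⟩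
  · rw [h]
    exact Or.inl (rotTree_adj_parent hx (by simp))
  · rw [h]
    exact Or.inl (rotTree_adj_parent hx (by simp))
  · rw [h] at hy ⊢
    refine Or.inl (Adj.symm ?_)
    convert! rotTree_adj_parent hy (by simp) using 1
    cases w with
    | nil => exact hx.2.1.elim
    | cons c l => rfl
  · rw [h]
    exact Or.inr ⟨hl, (flip_eq_some hx.2.1 hd hf).2.1.trans hl⟩
  · rw [h]
    exact Or.inr ⟨length_altWord .., length_altWord ..⟩
  · rw [h]
    exact Or.inr ⟨length_altWord .., length_altWord ..⟩

lemma rotTree_adj_iff {x y : RotVert r α β} : (D.rotTree r).Adj x y ↔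
    x ∈ D.verts ∧ y ∈ D.verts ∧ (x ≠ top ∧ D.parent x = y ∨ y ≠ top ∧ D.parent y = x) := by
  constructor
  · intro h
    obtain ⟨hx, hy, _, h⟩ := ofRel_adj.1 h
    exact ⟨hx, hy, h⟩
  · rintro ⟨hx, hy, ⟨hne, rfl⟩ | ⟨hne, rfl⟩⟩
    exacts [rotTree_adj_parent hx hne, (rotTree_adj_parent hy hne).symm]

lemma rotTree_adj_top_iff {y : RotVert r α β} :
    (D.rotTree r).Adj top y ↔ ∃ j, old j D.root = y := by
  rw [rotTree_adj_iff]
  constructor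
  · rintro ⟨-, hy, ⟨h, -⟩ | ⟨hne, h⟩⟩
    · exact absurd rfl h
    match y with
    | top => exact absurd rfl hne
    | old j v =>
      by_cases hv : v = D.root
      · exact ⟨j, by rw [hv]⟩
      · simp [parent, hv] at h
    | word j v e [] => exact hy.2.1.elim
    | word j v e [c] => simp [parent] at h
    | word j v e (c :: c' :: l) => simp [parent] at h
  · rintro ⟨j, rfl⟩
    exact ⟨trivial, D.root_mem, Or.inr ⟨by simp, by simp [parent]⟩⟩

lemma rotTree_adj_old_iff {j : ZMod r} {v : α} (hv : v ∈ V(G)) {y : RotVert r α β} :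
    (D.rotTree r).Adj (old j v) y ↔ ∃ e, G.Inc e v ∧ D.oldNbr j v e = y := by
  rw [rotTree_adj_iff]
  constructor
  · rintro ⟨-, hy, ⟨-, h⟩ | ⟨hne, h⟩⟩
    · refine ⟨D.edge v, ?_, by simpa [oldNbr] using h⟩
      by_cases hv' : v = D.root
      · exact hv' ▸ D.link_root.inc_left
      · exact (D.link v hv hv').inc_left
    match y with
    | top => exact absurd rfl hne
    | old j' v' =>
      by_cases hv' : v' = D.root
      · simp [parent, hv'] at h
      · simp only [parent, hv', if_false, old.injEq] at h
        obtain ⟨rfl, rfl⟩ := h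
        exact ⟨D.edge v', (D.link v' hy hv').inc_right, oldNbr_edge_par hy hv'⟩
    | word j' v' e [] => exact hy.2.1.elim
    | word j' v' e [c] =>
      simp only [parent, old.injEq] at h
      obtain ⟨rfl, rfl⟩ := h
      obtain rfl : c = 0 := hy.2.1
      exact ⟨e, hy.1.inc, hy.1.oldNbr⟩
    | word j' v' e (c :: c' :: l) => simp [parent] at h
  · rintro ⟨e, he, rfl⟩
    rcases inc_cases (D := D) he with ⟨rfl, rfl⟩ | ⟨hv', rfl⟩ | ⟨w, hw, hne, rfl, rfl⟩ | hh
    · rw [oldNbr_rootEdge]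
      exact ⟨hv, trivial, Or.inl ⟨by simp, by simp [parent]⟩⟩
    · rw [oldNbr_edge hv']
      exact ⟨hv, D.par_mem hv hv', Or.inl ⟨by simp, by simp [parent, hv']⟩⟩
    · rw [oldNbr_edge_par hw hne]
      exact ⟨hv, hw, Or.inr ⟨by simp, by simp [parent, hne]⟩⟩
    · rw [hh.oldNbr]
      exact ⟨hv, ⟨hh, rfl, by have := D.two_le_len hv; simp; omega⟩,
        Or.inr ⟨by simp, rfl⟩⟩

lemma rotTree_adj_iff_of_not_isLeaf {x y : RotVert r α β} (hx : ¬ D.IsLeaf x) :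
    (D.rotTree r).Adj x y ↔ (D.rotGraph r).Adj x y :=
  ⟨fun h => h.mono rotTree_isSpanningSubgraph.le,
    fun h => (rotTree_adj_or_isLeaf h).resolve_right fun h => hx h.1⟩

lemma rotGraph_adj_top_iff {y : RotVert r α β} :
    (D.rotGraph r).Adj top y ↔ ∃ j, old j D.root = y := by
  rw [← rotTree_adj_iff_of_not_isLeaf id, rotTree_adj_top_iff]

lemma rotGraph_adj_old_iff {j : ZMod r} {v : α} (hv : v ∈ V(G))
    {y : RotVert r α β} :
    (D.rotGraph r).Adj (old j v) y ↔ ∃ e, G.Inc e v ∧ D.oldNbr j v e = y := by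
  rw [← rotTree_adj_iff_of_not_isLeaf id, rotTree_adj_old_iff hv]

lemma degree_rotGraph (hG : G.IsRGraph r) (hr : Odd r) {x : RotVert r α β} (hx : x ∈ D.verts) :
    (D.rotGraph r).degree x = r := by
  have : NeZero r := ⟨hr.pos.ne'⟩
  rw [rotGraph, degree_ofRel]
  change {y | (D.rotGraph r).Adj x y}.ncard = r
  have hrange : ∀ f : ZMod r → RotVert r α β, Function.Injective f →
      {y | ∃ d, f d = y}.ncard = r := fun f hf => by
    change (range f).ncard = r
    rw [← image_univ, ncard_image_of_injective _ hf, ncard_univ, Nat.card_zmod]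
  cases x with
  | top =>
    simp only [rotGraph_adj_top_iff]
    exact hrange _ fun _ _ h => by injection h
  | old j v =>
    simp only [rotGraph_adj_old_iff hx]
    change (D.oldNbr j v '' G.incidenceSet v).ncard = r
    rw [oldNbr_injOn.ncard_image]
    exact hG.regular v hx
  | word j v e w =>
    simp only [rotGraph_adj_word_iff hG.loopless hr hx]
    exact hrange _ (nbr_injective hG.loopless hr hx)

lemma degree_rotTree_of_not_isLeaf (hG : G.IsRGraph r) (hr : Odd r) {x : RotVert r α β}
    (hx : x ∈ D.verts) (hl : ¬ D.IsLeaf x) : (D.rotTree r).degree x = r := by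
  refine Eq.trans ?_ (degree_rotGraph hG hr hx)
  rw [rotTree, ofParent, degree_ofRel, rotGraph, degree_ofRel]
  congr 1
  ext y
  exact rotTree_adj_iff_of_not_isLeaf hl

lemma degree_rotTree_of_isLeaf {x : RotVert r α β}
    (hx : x ∈ D.verts) (hl : D.IsLeaf x) : (D.rotTree r).degree x = 1 := by
  rw [rotTree, ofParent, degree_ofRel, ncard_eq_one]
  refine ⟨D.parent x, ?_⟩
  ext y
  have h : (D.rotTree r).Adj x y ↔ y = D.parent x := by
    constructor
    · rw [rotTree_adj_iff]
      rintro ⟨-, hy, ⟨-, h⟩ | ⟨hne, rfl⟩⟩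
      · exact h.symm
      exfalso
      match y with
      | top => exact absurd rfl hne
      | old j' v' =>
        by_cases hv : v' = D.root <;> simp [parent, hv, IsLeaf] at hl
      | word j' v' e' [] => exact hy.2.1.elim
      | word j' v' e' [c] => exact hl
      | word j' v' e' (c :: c' :: l) =>
        have h1 := hy.2.2
        have h2 : (c' :: l).length = D.len v' := hl
        simp only [List.length_cons] at h1 h2
        omega
    · rintro rfl
      exact rotTree_adj_parent hx (by rintro rfl; exact hl)
  exact h

lemma finite_verts (hG : G.IsRGraph r) (hr : Odd r) : (D.verts : Set (RotVert r α β)).Finite := by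
  have : NeZero r := ⟨hr.pos.ne'⟩
  have hf : Finite (ZMod r) := inferInstance
  have h1 : ({top} : Set (RotVert r α β)).Finite := finite_singleton _
  have h2 := ((univ : Set (ZMod r)).toFinite.prod hG.finite_vertexSet).image
    fun p => (old p.1 p.2 : RotVert r α β)
  have h3 := (((univ : Set (ZMod r)).toFinite.prod hG.finite_vertexSet).prod
    (hG.finite_edgeSet.prod (finite_setOf_isWord (r := r) (D.height + 2)))).image
    fun p => (word p.1.1 p.1.2 p.2.1 p.2.2 : RotVert r α β)
  refine ((h1.union h2).union h3).subset ?_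
  rintro (_ | ⟨j, v⟩ | ⟨j, v, e, w⟩) hx
  · exact Or.inl (Or.inl rfl)
  · exact Or.inl (Or.inr ⟨(j, v), ⟨trivial, hx⟩, rfl⟩)
  · refine Or.inr ⟨((j, v), e, w), ⟨⟨trivial, hx.1.vertex_mem⟩, hx.1.inc.edge_mem, hx.2.1, ?_⟩, rfl⟩
    exact hx.2.2.trans (Nat.sub_le _ _)

/-- A leaf at `v` has level `D.depth v + 1 + D.len v`, and `D.len` was chosen to make this `D.height
+ 3` for all `v`. -/
lemma isBalancedTree_rotTree (hG : G.IsRGraph r) (hr : Odd r) (h1 : 1 < r) :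
    (D.rotTree r).IsBalancedTree r (D.height + 3) ⟨top, trivial⟩ where
  isTree := isTree_ofParent (d := D.level) (finite_verts hG hr) (fun _ => D.parent_mem)
    trivial rfl
  degree_eq x hx := by
    by_cases hl : D.IsLeaf x
    · exact Or.inl (degree_rotTree_of_isLeaf hx hl)
    · exact Or.inr (degree_rotTree_of_not_isLeaf hG hr hx hl)
  dist_leaf x hdeg := by
    refine (dist_ofParent (d := D.level) (fun _ => D.parent_mem) trivial rfl x).trans ?_
    obtain ⟨x, hx⟩ := x
    have hl : D.IsLeaf x := by
      by_contra hl
      have := degree_rotTree_of_not_isLeaf hG hr hx hl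
      rw [hdeg] at this
      omega
    cases x with
    | top => exact hl.elim
    | old j v => exact hl.elim
    | word j v e w =>
      have h2 : w.length = D.len v := hl
      have h3 := D.depth_le v hx.1.vertex_mem
      change D.depth v + 1 + w.length = _
      rw [h2, len]
      omega

end RootedTree

/-! ### The rotation -/

namespace RotVert

variable {r : ℕ} {α β : Type*}

/-- Add `k` to the index of the copy. -/
def shift (k : ZMod r) : RotVert r α β → RotVert r α β
  | top => top
  | old j v => old (j + k) v
  | word j v e w => word (j + k) v e w

lemma shift_shift (k l : ZMod r) (x : RotVert r α β) : shift k (shift l x) = shift (l + k) x := by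
  cases x <;> simp [shift, add_assoc]

@[simp] lemma shift_zero (x : RotVert r α β) : shift 0 x = x := by
  cases x <;> simp [shift]

@[simp] lemma shift_neg_shift (k : ZMod r) (x : RotVert r α β) : shift (-k) (shift k x) = x := by
  simp [shift_shift]

@[simp] lemma shift_shift_neg (k : ZMod r) (x : RotVert r α β) : shift k (shift (-k) x) = x := by
  simp [shift_shift]

lemma iterate_shift (n : ℕ) (x : RotVert r α β) : (shift 1)^[n] x = shift (n : ZMod r) x := by
  induction n with
  | zero => simp
  | succ n ih => rw [Function.iterate_succ_apply', ih, shift_shift, Nat.cast_succ]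

lemma minimalPeriod_shift {x : RotVert r α β} (hx : x ≠ top) :
    Function.minimalPeriod (shift 1) x = r := by
  have key : ∀ n : ℕ, Function.IsPeriodicPt (shift 1) n x ↔ r ∣ n := by
    intro n
    rw [Function.IsPeriodicPt, Function.IsFixedPt, iterate_shift,
      ← ZMod.natCast_eq_zero_iff]
    cases x with
    | top => exact absurd rfl hx
    | old j v => simp [shift]
    | word j v e w => simp [shift]
  refine Nat.dvd_antisymm ?_ ?_
  · rw [← Function.isPeriodicPt_iff_minimalPeriod_dvd, key]
  · rw [← key]
    exact Function.isPeriodicPt_minimalPeriod _ _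

end RotVert

namespace RootedTree

open RotVert

variable {α β : Type*} {G : Graph α β} {D : RootedTree G} {r : ℕ}

lemma parent_shift (k : ZMod r) (x : RotVert r α β) :
    D.parent (shift k x) = shift k (D.parent x) := by
  match x with
  | top => rfl
  | old j v => by_cases hv : v = D.root <;> simp [shift, parent, hv]
  | word j v e [] => rfl
  | word j v e [c] => rfl
  | word j v e (c :: c' :: l) => rfl

lemma nbr_shift (k j : ZMod r) (v : α) (e : β) (w : List (ZMod r)) (d : ZMod r) :
    D.nbr (j + k) v e w d = shift k (D.nbr j v e w d) := by
  unfold nbr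
  split_ifs
  · exact parent_shift k (word j v e w)
  · rfl
  · cases flip d w with
    | some w' => rfl
    | none => simp only [shift]; congr 1; ring
  · cases flip d w <;> rfl

lemma shift_eq_top_iff {k : ZMod r} {x : RotVert r α β} : shift k x = top ↔ x = top := by
  cases x <;> simp [shift]

lemma rel_shift (k : ZMod r) {x y : RotVert r α β} (h : D.rel x y) :
    D.rel (shift k x) (shift k y) := by
  rcases h with ⟨hne, rfl⟩ | ⟨j, v, e, w, d, rfl, rfl⟩
  · exact Or.inl ⟨by rwa [Ne, shift_eq_top_iff], parent_shift k x⟩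
  · exact Or.inr ⟨_, _, _, _, d, rfl, nbr_shift ..⟩

lemma shift_mem (k : ZMod r) {x : RotVert r α β} (h : x ∈ D.verts) : shift k x ∈ D.verts := by
  cases x <;> exact h

lemma bijOn_shift (k : ZMod r) : BijOn (shift k) (D.verts : Set (RotVert r α β)) D.verts :=
  InvOn.bijOn (f' := shift (-k)) ⟨fun x _ => by simp, fun x _ => by simp⟩
    (fun _ => shift_mem k) (fun _ => shift_mem _)

lemma isAutomorphism_rotGraph : (D.rotGraph r).IsAutomorphism (shift 1) :=
  isAutomorphism_ofRel (bijOn_shift 1) fun x y =>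
    ⟨fun h => by simpa using rel_shift (-1) h, rel_shift 1⟩

lemma isRotational_rotTree (hG : G.IsRGraph r) (hr : Odd r) :
    (D.rotTree r).IsRotational (shift 1) top where
  isAutomorphism := isAutomorphism_ofRel (bijOn_shift 1) fun x y => by
    rw [Ne, shift_eq_top_iff, parent_shift]
    refine and_congr_right fun _ => ⟨fun h => ?_, fun h => by rw [h]⟩
    simpa using congrArg (shift (-1)) h
  fixed := Function.minimalPeriod_eq_one_iff_isFixedPt.2 rfl
  period x _ hne := by
    rw [minimalPeriod_shift hne]
    exact (degree_rotTree_of_not_isLeaf hG hr (x := top) trivial id).symm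

end RootedTree

/-! ### Parity, and cuts crossed by edge-disjoint walks -/

section Parity

variable {γ : Type*}

lemma even_ncard_of_involution {K : Set γ} (hK : K.Finite) (m : γ → γ) (hmem : ∀ x ∈ K, m x ∈ K)
    (hinv : ∀ x ∈ K, m (m x) = x) (hne : ∀ x ∈ K, m x ≠ x) : Even K.ncard := by
  lift K to Finset γ using hK
  rw [ncard_coe_finset, ← ZMod.natCast_eq_zero_iff_even]
  have := Finset.sum_involution (s := K) (f := fun _ => (1 : ZMod 2)) (fun x _ => m x)
    (fun _ _ => by decide) (fun x hx _ => hne x hx) (fun x hx => hmem x hx)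
    (fun x hx => hinv x hx)
  simpa using this

lemma exists_odd_ncard_fiber {ι : Type*} {S : Set γ} (hS : S.Finite) (hodd : Odd S.ncard)
    (f : γ → ι) : ∃ i, Odd {x | x ∈ S ∧ f x = i}.ncard := by
  classical
  lift S to Finset γ using hS
  by_contra! h
  rw [ncard_coe_finset, Finset.card_eq_sum_card_image f S, ← Nat.not_even_iff_odd] at hodd
  refine hodd (Finset.even_sum _ fun i _ => ?_)
  have := h i
  rw [Nat.not_odd_iff_even] at this
  rw [← ncard_coe_finset]
  convert! this using 2
  ext x
  simp

end Parity

section Linked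

variable {γ : Type*} {H : Graph γ (Sym2 γ)}

/-- `x` and `y` are joined by a walk all of whose edges have an end satisfying `N`. -/
def Linked (H : Graph γ (Sym2 γ)) (N : γ → Prop) : γ → γ → Prop :=
  Relation.ReflTransGen fun a b => H.Adj a b ∧ (N a ∨ N b)

lemma Linked.trans {N : γ → Prop} {x y z : γ} (h : Linked H N x y) (h' : Linked H N y z) :
    Linked H N x z := Relation.ReflTransGen.trans h h'

lemma Linked.symm {N : γ → Prop} {x y : γ} (h : Linked H N x y) : Linked H N y x := by
  have hs : Std.Symm fun a b => H.Adj a b ∧ (N a ∨ N b) :=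
    ⟨fun _ _ ⟨h1, h2⟩ => ⟨h1.symm, h2.symm⟩⟩
  exact Std.Symm.symm (r := Relation.ReflTransGen _) _ _ h

lemma Linked.mono {N N' : γ → Prop} (hN : ∀ a, N a → N' a) {x y : γ} (h : Linked H N x y) :
    Linked H N' x y :=
  Relation.ReflTransGen.mono (fun _ _ h => ⟨h.1, h.2.imp (hN _) (hN _)⟩) _ _ h

lemma Linked.of_adj_left {N : γ → Prop} {x y : γ} (h : H.Adj x y) (hx : N x) : Linked H N x y :=
  Relation.ReflTransGen.single ⟨h, Or.inl hx⟩

lemma Linked.of_adj_right {N : γ → Prop} {x y : γ} (h : H.Adj x y) (hy : N y) : Linked H N x y :=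
  Relation.ReflTransGen.single ⟨h, Or.inr hy⟩

/-- A part `K` of a graph with `r` disjoint perfect matchings, where the edges of these matchings
that do not belong to the graph are replaced by edge-disjoint walks outside of `K`. -/
lemma le_ncard_edgeBoundary_of_coloring {r : ℕ} (hr : Odd r) {V : Set γ} {A : γ → γ → Prop}
    (hV : V.Finite) {K : Set γ} (hKV : K ⊆ V) (m : ZMod r → γ → γ) (N : ZMod r → γ → Prop)
    (hmem : ∀ d, ∀ x ∈ K, m d x ∈ K) (hinv : ∀ d, ∀ x ∈ K, m d (m d x) = x)
    (hne : ∀ d, ∀ x ∈ K, m d x ≠ x) (hinj : ∀ x ∈ K, Function.Injective fun d => m d x)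
    (hNK : ∀ d a, N d a → a ∉ K)
    (hNN : ∀ d d' a b, (ofRel V A).Adj a b → (N d a ∨ N d b) → (N d' a ∨ N d' b) → d = d')
    (hlink : ∀ d, ∀ x ∈ K, (ofRel V A).Adj x (m d x) ∨ Linked (ofRel V A) (N d) x (m d x))
    {S : Set γ} (hodd : Odd {x | x ∈ S ∧ x ∈ K}.ncard) :
    r ≤ ((ofRel V A).edgeBoundary S).ncard := by
  have : NeZero r := ⟨hr.pos.ne'⟩
  have hcard : (univ : Set (ZMod r)).ncard = r := by rw [ncard_univ, Nat.card_zmod]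
  refine hcard.symm.trans_le ?_
  -- The family of color `d` consists of its matching edges inside `K` and of the edges with an end
  -- in `N d`. The former have both ends in `K`, the latter have an end outside, so families of
  -- different colors are disjoint.
  refine ncard_le_ncard_edgeBoundary hV (I := univ)
    (E := fun d a b => (ofRel V A).Adj a b ∧ ((a ∈ K ∧ b ∈ K ∧ m d a = b) ∨ (N d a ∨ N d b)))
    (fun d _ a b h => h.1) ?_ ?_
  · rintro d - d' - a b ⟨h, h1⟩ h'
    have h2 : (a ∈ K ∧ b ∈ K ∧ m d' a = b) ∨ (N d' a ∨ N d' b) := by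
      rcases h' with ⟨-, h'⟩ | ⟨-, ⟨hb, ha, rfl⟩ | h'⟩
      · exact h'
      · exact Or.inl ⟨ha, hb, hinv _ _ hb⟩
      · exact Or.inr h'.symm
    rcases h1 with ⟨ha, hb, h1⟩ | h1 <;> rcases h2 with ⟨ha', hb', h2⟩ | h2
    · exact hinj a ha (h1.trans h2.symm)
    · exact (h2.elim (fun h => hNK _ _ h ha) fun h => hNK _ _ h hb).elim
    · exact (h1.elim (fun h => hNK _ _ h ha') fun h => hNK _ _ h hb').elim
    · exact hNN _ _ _ _ h h1 h2
  · rintro d -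
    -- Otherwise `m d` would be an involution of `S ∩ K` without fixed points, and this set would be
    -- even.
    have hex : ∃ x ∈ S, x ∈ K ∧ m d x ∉ S := by
      by_contra! hcon
      have := even_ncard_of_involution (K := {x | x ∈ S ∧ x ∈ K})
        (hV.subset fun x hx => hKV hx.2) (m d)
        (fun x hx => ⟨hcon x hx.1 hx.2, hmem d x hx.2⟩) (fun x hx => hinv d x hx.2)
        (fun x hx => hne d x hx.2)
      exact Nat.not_even_iff_odd.2 hodd this
    obtain ⟨x, hx, hxK, hmx⟩ := hex
    refine ⟨x, hx, m d x, hmx, ?_⟩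
    rcases hlink d x hxK with h | h
    · exact Relation.ReflTransGen.single ⟨h, Or.inl ⟨hxK, hmem d x hxK, rfl⟩⟩
    · exact Relation.ReflTransGen.mono (fun _ _ h => ⟨h.1, Or.inr h.2⟩) _ _ h

end Linked

/-! ### Cuts that are odd on the words of one old edge -/

namespace RootedTree

open RotVert

variable {α β : Type*} {G : Graph α β} {D : RootedTree G} {r : ℕ}

/-- The old vertices of the copy with index `j`. -/
def OldIn (j : ZMod r) : RotVert r α β → Prop
  | old j' _ => j' = j
  | _ => False

/-- The words at the ends of the edge `e` in the copy with index `j`. -/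
def WordIn (j : ZMod r) (e : β) : RotVert r α β → Prop
  | word j' _ e' _ => j' = j ∧ e' = e
  | _ => False

lemma linked_old_top {j : ZMod r} {v : α} (hv : v ∈ V(G)) :
    Linked (D.rotGraph r) (OldIn j) (old j v) top := by
  induction hn : D.depth v generalizing v with
  | zero =>
    have hv' : v = D.root := by
      by_contra hne
      have := D.depth_eq v hv hne
      omega
    refine Linked.of_adj_left (rotGraph_adj_top_iff.2 ⟨j, ?_⟩).symm rfl
    rw [hv']
  | succ n ih =>
    have hne : v ≠ D.root := by
      rintro rfl
      rw [D.depth_root] at hn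
      omega
    have hd := D.depth_eq v hv hne
    refine (Linked.of_adj_left (N := OldIn j) (x := old j v) (y := old j (D.par v)) ?_ rfl).trans
      (ih (D.par_mem hv hne) (by omega))
    exact (rotGraph_adj_old_iff hv).2 ⟨_, (D.link v hv hne).inc_left, oldNbr_edge hne⟩

lemma linked_word_old {j : ZMod r} {v : α} {e : β} {w : List (ZMod r)}
    (hx : (word j v e w : RotVert r α β) ∈ D.verts) :
    Linked (D.rotGraph r) (WordIn j e) (word j v e w) (old j v) := by
  induction w with
  | nil => exact hx.2.1.elim
  | cons c l ih =>
    have h := rotGraph_adj_parent hx (by simp)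
    cases l with
    | nil => exact Linked.of_adj_left h ⟨rfl, rfl⟩
    | cons c' l =>
      refine (Linked.of_adj_left h ⟨rfl, rfl⟩).trans (ih ⟨hx.1, hx.2.1.2, ?_⟩)
      have := hx.2.2
      simp only [List.length_cons] at this ⊢
      omega

lemma nbr_zero_singleton_ne {j : ZMod r} {v : α} {e : β} (hv : v ∈ V(G)) {d : ZMod r}
    (hd : d ≠ 0) : D.nbr j v e [0] d = word j v e [d, 0] :=
  nbr_of_length_lt hd (by have := D.two_le_len hv; simp; omega)

variable (D) in
/-- The words at the ends of the edge `e` in the copy with index `j`. -/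
def wordPart (j : ZMod r) (e : β) : Set (RotVert r α β) := {x | x ∈ D.verts ∧ WordIn j e x}

variable (D) in
/-- The matching of color `d` on the words at the ends of an edge. -/
noncomputable def wordMatch (d : ZMod r) : RotVert r α β → RotVert r α β
  | word j v e w => if w = [0] ∧ d = 0 then word j (D.other e v) e [0] else D.nbr j v e w d
  | x => x

section wordMatch

variable {j : ZMod r} {e : β} {d : ZMod r} {x : RotVert r α β}

lemma wordMatch_of_eq {v : α} : D.wordMatch (0 : ZMod r) (word j v e [0]) =
    word j (D.other e v) e [0] := if_pos ⟨rfl, rfl⟩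

lemma wordMatch_of_ne {v : α} {w : List (ZMod r)} (h : ¬ (w = [0] ∧ d = 0)) :
    D.wordMatch d (word j v e w) = D.nbr j v e w d := if_neg h

lemma word_singleton_mem {v : α} (h : D.IsHalf e v) :
    (word j v e [0] : RotVert r α β) ∈ D.verts :=
  ⟨h, rfl, by have := D.two_le_len h.vertex_mem; simp; omega⟩

/-- Away from `rootEdge` the way back along an edge stays in the copy, so it has the same color.
Only color `0` leaves the part, at the two words `[0]`, and these are matched with each other
instead. -/
lemma wordMatch_spec (hr : Odd r) (he : e ≠ D.rootEdge) (hx : x ∈ D.wordPart j e) :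
    D.wordMatch d x ∈ D.wordPart j e ∧ D.wordMatch d (D.wordMatch d x) = x := by
  obtain ⟨hx, hw⟩ := hx
  match x with
  | top => exact hw.elim
  | old _ _ => exact hw.elim
  | word j' v e' w =>
    obtain ⟨rfl, rfl⟩ := hw
    by_cases h0 : w = [0] ∧ d = 0
    · obtain ⟨rfl, rfl⟩ := h0
      rw [wordMatch_of_eq, wordMatch_of_eq, D.other_other hx.1.inc]
      exact ⟨⟨word_singleton_mem (hx.1.other he), rfl, rfl⟩, rfl⟩
    · obtain ⟨j₁, v₁, w₁, d₁, h1, h2, h3, h4, h5, h6⟩ := exists_nbr_eq hr hx h0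
      obtain rfl := h6 he
      obtain rfl : d₁ = d := add_left_cancel h5
      rw [wordMatch_of_ne h0, h1, wordMatch_of_ne h4]
      exact ⟨⟨h2, rfl, rfl⟩, h3⟩

lemma wordMatch_ne (hG : G.Loopless) (hr : Odd r) (hx : x ∈ D.wordPart j e) :
    D.wordMatch d x ≠ x := by
  obtain ⟨hx, hw⟩ := hx
  match x with
  | top => exact hw.elim
  | old _ _ => exact hw.elim
  | word j' v e' w =>
    by_cases h0 : w = [0] ∧ d = 0
    · obtain ⟨rfl, rfl⟩ := h0
      rw [wordMatch_of_eq]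
      intro h
      have h' : D.other e' v = v := by injection h
      exact (D.isLink_other hx.1.inc).ne h'.symm
    · rw [wordMatch_of_ne h0]
      exact nbr_ne hG hr hx

lemma wordMatch_injective (hG : G.Loopless) (hr : Odd r) (hx : x ∈ D.wordPart j e) :
    Function.Injective fun d => D.wordMatch d x := by
  obtain ⟨hx, hw⟩ := hx
  match x with
  | top => exact hw.elim
  | old _ _ => exact hw.elim
  | word j' v e' w =>
    intro d d' h
    by_cases h0 : w = [0] ∧ d = 0 <;> by_cases h0' : w = [0] ∧ d' = 0
    · rw [h0.2, h0'.2]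
    · obtain ⟨rfl, rfl⟩ := h0
      simp only [wordMatch_of_ne h0', wordMatch_of_eq] at h
      rw [nbr_zero_singleton_ne hx.1.vertex_mem fun h => h0' ⟨rfl, h⟩] at h
      simp at h
    · obtain ⟨rfl, rfl⟩ := h0'
      simp only [wordMatch_of_ne h0, wordMatch_of_eq] at h
      rw [nbr_zero_singleton_ne hx.1.vertex_mem fun h => h0 ⟨rfl, h⟩] at h
      simp at h
    · simp only [wordMatch_of_ne h0, wordMatch_of_ne h0'] at h
      exact nbr_injective hG hr hx h

lemma finite_wordPart (hG : G.IsRGraph r) (hr : Odd r) :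
    (D.wordPart j e : Set (RotVert r α β)).Finite := (finite_verts hG hr).subset fun _ h => h.1

lemma even_ncard_wordPart (hG : G.IsRGraph r) (hr : Odd r) (he : e ≠ D.rootEdge) :
    Even (D.wordPart j e : Set (RotVert r α β)).ncard :=
  even_ncard_of_involution (finite_wordPart hG hr) (D.wordMatch 0)
    (fun _ hx => (wordMatch_spec hr he hx).1) (fun _ hx => (wordMatch_spec hr he hx).2)
    (fun _ hx => wordMatch_ne hG.loopless hr hx)

lemma rotGraph_adj_word_old {v : α} (h : D.IsHalf e v) :
    (D.rotGraph r).Adj (word j v e [0]) (old j v) :=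
  rotGraph_adj_parent (word_singleton_mem h) (by simp)

/-- The one matching edge that may be missing from the graph joins the two words `[0]` in color `0`.
It is replaced by a walk through the tree of copy `j` and `top`. -/
lemma le_boundary_of_odd_wordPart (hG : G.IsRGraph r) (hr : Odd r) (he : e ≠ D.rootEdge)
    {S : Set (RotVert r α β)} (hodd : Odd {x | x ∈ S ∧ x ∈ D.wordPart j e}.ncard) :
    r ≤ ((D.rotGraph r).edgeBoundary S).ncard := by
  refine le_ncard_edgeBoundary_of_coloring hr (finite_verts hG hr) (fun _ h => h.1)
    D.wordMatch (fun d x => d = 0 ∧ OldIn j x)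
    (fun _ _ hx => (wordMatch_spec hr he hx).1) (fun _ _ hx => (wordMatch_spec hr he hx).2)
    (fun _ _ hx => wordMatch_ne hG.loopless hr hx)
    (fun _ hx => wordMatch_injective hG.loopless hr hx) ?_ ?_ ?_ hodd
  · rintro d a ⟨-, ha⟩ ⟨-, hw⟩
    cases a <;> first | exact ha | exact hw
  · intro d d' a b _ h h'
    have h1 : d = 0 := by tauto
    have h2 : d' = 0 := by tauto
    rw [h1, h2]
  · rintro d x ⟨hx, hw⟩
    match x with
    | top => exact hw.elim
    | old _ _ => exact hw.elim
    | word j' v e' w =>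
      obtain ⟨rfl, rfl⟩ := hw
      by_cases h0 : w = [0] ∧ d = 0
      · obtain ⟨rfl, rfl⟩ := h0
        rw [wordMatch_of_eq]
        right
        refine Linked.mono (N := OldIn j') (fun a h => ⟨rfl, h⟩) ?_
        have hh := hx.1.other he
        have h1 : Linked (D.rotGraph r) (OldIn j') (word j' v e' [0]) (old j' v) :=
          Linked.of_adj_right (rotGraph_adj_word_old hx.1) rfl
        have h2 : Linked (D.rotGraph r) (OldIn j') (word j' (D.other e' v) e' [0])
            (old j' (D.other e' v)) :=
          Linked.of_adj_right (rotGraph_adj_word_old hh) rfl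
        exact (h1.trans (linked_old_top hx.1.vertex_mem)).trans
          (h2.trans (linked_old_top hh.vertex_mem)).symm
      · rw [wordMatch_of_ne h0]
        exact Or.inl ((rotGraph_adj_word_iff hG.loopless hr hx).2 ⟨d, rfl⟩)

end wordMatch

end RootedTree

/-! ### Cuts that are odd on the root part or on a copy of the old vertices -/

namespace RootedTree

open RotVert

variable {α β : Type*} {G : Graph α β} {D : RootedTree G} {r : ℕ}

variable (r D) in
/-- The root and the words at the ends of `rootEdge`. -/
def rootPart : Set (RotVert r α β) :=
  {x | x ∈ D.verts ∧ match x with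
    | top => True
    | old _ _ => False
    | word _ _ e _ => e = D.rootEdge}

variable (D) in
/-- The matching of color `d` on `rootPart`. -/
noncomputable def rootMatch (d : ZMod r) : RotVert r α β → RotVert r α β
  | top => word d D.mate D.rootEdge [0]
  | old j v => old j v
  | word j v e w => if w = [0] ∧ d - j = 0 then top else D.nbr j v e w (d - j)

lemma rootMatch_of_eq {d : ZMod r} {v : α} {e : β} : D.rootMatch d (word d v e [0]) = top :=
  if_pos ⟨rfl, sub_self d⟩

lemma rootMatch_of_ne {d j : ZMod r} {v : α} {e : β} {w : List (ZMod r)}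
    (h : ¬ (w = [0] ∧ d - j = 0)) : D.rootMatch d (word j v e w) = D.nbr j v e w (d - j) :=
  if_neg h

/-- Edges are colored by copy plus color, which `exists_nbr_eq` preserves. In this coloring the
words `[0]` of the different copies lack different colors, and `top` is matched with the word of
copy `d` in color `d`. -/
lemma rootMatch_spec (hG : G.Loopless) (hr : Odd r) {d : ZMod r} {x : RotVert r α β}
    (hx : x ∈ D.rootPart r) :
    D.rootMatch d x ∈ D.rootPart r ∧ D.rootMatch d (D.rootMatch d x) = x := by
  obtain ⟨hx, hw⟩ := hx
  match x with
  | top => exact ⟨⟨word_singleton_mem (isHalf_mate hG), rfl⟩, rootMatch_of_eq⟩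
  | old _ _ => exact hw.elim
  | word j v e w =>
    obtain rfl : e = D.rootEdge := hw
    by_cases h0 : w = [0] ∧ d - j = 0
    · obtain ⟨rfl, h0⟩ := h0
      obtain rfl := sub_eq_zero.1 h0
      rw [rootMatch_of_eq]
      exact ⟨⟨trivial, trivial⟩, by rw [hx.1.eq_mate]; rfl⟩
    · obtain ⟨j₁, v₁, w₁, d₁, h1, h2, h3, h4, h5, h6⟩ := exists_nbr_eq hr hx h0
      have hd : d - j₁ = d₁ := by linear_combination -h5
      rw [rootMatch_of_ne h0, h1, rootMatch_of_ne (by rwa [hd]), hd]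
      exact ⟨⟨h2, rfl⟩, h3⟩

lemma rootMatch_ne (hG : G.Loopless) (hr : Odd r) {d : ZMod r} {x : RotVert r α β}
    (hx : x ∈ D.rootPart r) : D.rootMatch d x ≠ x := by
  obtain ⟨hx, hw⟩ := hx
  match x with
  | top => simp [rootMatch]
  | old _ _ => exact hw.elim
  | word j v e w =>
    by_cases h0 : w = [0] ∧ d - j = 0
    · obtain ⟨rfl, h0⟩ := h0
      obtain rfl := sub_eq_zero.1 h0
      simp [rootMatch_of_eq]
    · rw [rootMatch_of_ne h0]
      exact nbr_ne hG hr hx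

lemma rootMatch_injective (hG : G.Loopless) (hr : Odd r) {x : RotVert r α β}
    (hx : x ∈ D.rootPart r) : Function.Injective fun d => D.rootMatch d x := by
  obtain ⟨hx, hw⟩ := hx
  intro d d' h
  match x with
  | top => simpa [rootMatch] using h
  | old _ _ => exact hw.elim
  | word j v e w =>
    by_cases h0 : w = [0] ∧ d - j = 0 <;> by_cases h0' : w = [0] ∧ d' - j = 0
    · exact sub_left_injective (h0.2.trans h0'.2.symm)
    · obtain ⟨rfl, h0⟩ := h0
      obtain rfl := sub_eq_zero.1 h0
      simp only [rootMatch_of_ne h0', rootMatch_of_eq] at h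
      rw [nbr_zero_singleton_ne hx.1.vertex_mem fun h => h0' ⟨rfl, h⟩] at h
      simp at h
    · obtain ⟨rfl, h0'⟩ := h0'
      obtain rfl := sub_eq_zero.1 h0'
      simp only [rootMatch_of_ne h0, rootMatch_of_eq] at h
      rw [nbr_zero_singleton_ne hx.1.vertex_mem fun h => h0 ⟨rfl, h⟩] at h
      simp at h
    · simp only [rootMatch_of_ne h0, rootMatch_of_ne h0'] at h
      exact sub_left_injective (nbr_injective hG hr hx h)

lemma linked_top_mate (hG : G.Loopless) {d : ZMod r} :
    Linked (D.rotGraph r) (OldIn d) top (word d D.mate D.rootEdge [0]) :=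
  (linked_old_top (isHalf_mate hG).vertex_mem).symm.trans
    (Linked.of_adj_right (N := OldIn d) (x := word d D.mate D.rootEdge [0]) (y := old d D.mate)
      (rotGraph_adj_word_old (isHalf_mate hG)) rfl).symm

lemma eq_of_oldIn {d d' : ZMod r} {a b : RotVert r α β} (hab : (D.rotGraph r).Adj a b)
    (ha : OldIn d a) (hb : OldIn d' b) : d = d' := by
  match a, b with
  | top, _ => exact ha.elim
  | word _ _ _ _, _ => exact ha.elim
  | old j v, top => exact hb.elim
  | old j v, word _ _ _ _ => exact hb.elim
  | old j v, old j' v' =>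
    obtain rfl : j = d := ha
    obtain rfl : j' = d' := hb
    obtain ⟨h1, h2, h3, (⟨-, h⟩ | ⟨_, _, _, _, _, h, _⟩) | ⟨-, h⟩ | ⟨_, _, _, _, _, h, _⟩⟩ :=
      ofRel_adj.1 hab
    · by_cases hv : v = D.root
      · simp [parent, hv] at h
      · simp only [parent, hv, if_false, old.injEq] at h
        exact h.1
    · simp at h
    · by_cases hv : v' = D.root
      · simp [parent, hv] at h
      · simp only [parent, hv, if_false, old.injEq] at h
        exact h.1.symm
    · simp at h

/-- The missing edge of color `d` is replaced by a walk through the old vertices of copy `d`. No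
edge joins old vertices of different copies, so these walks are edge-disjoint. -/
lemma le_boundary_of_odd_rootPart (hG : G.IsRGraph r) (hr : Odd r)
    {S : Set (RotVert r α β)} (hodd : Odd {x | x ∈ S ∧ x ∈ D.rootPart r}.ncard) :
    r ≤ ((D.rotGraph r).edgeBoundary S).ncard := by
  refine le_ncard_edgeBoundary_of_coloring hr (finite_verts hG hr) (fun _ h => h.1)
    D.rootMatch OldIn
    (fun _ _ hx => (rootMatch_spec hG.loopless hr hx).1)
    (fun _ _ hx => (rootMatch_spec hG.loopless hr hx).2)
    (fun _ _ hx => rootMatch_ne hG.loopless hr hx)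
    (fun _ hx => rootMatch_injective hG.loopless hr hx) ?_ ?_ ?_ hodd
  · rintro d a ha ⟨-, hw⟩
    cases a <;> first | exact ha | exact hw
  · have hself : ∀ (d d' : ZMod r) (a : RotVert r α β), OldIn d a → OldIn d' a → d = d' := by
      intro d d' a ha ha'
      cases a <;> first | exact ha.elim | exact Eq.trans (Eq.symm ha) ha'
    rintro d d' a b hab (h | h) (h' | h')
    · exact hself _ _ _ h h'
    · exact eq_of_oldIn hab h h'
    · exact eq_of_oldIn hab.symm h h'
    · exact hself _ _ _ h h'
  · rintro d x ⟨hx, hw⟩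
    match x with
    | top => exact Or.inr (linked_top_mate hG.loopless)
    | old _ _ => exact hw.elim
    | word j v e w =>
      obtain rfl : e = D.rootEdge := hw
      by_cases h0 : w = [0] ∧ d - j = 0
      · obtain ⟨rfl, h0⟩ := h0
        obtain rfl := sub_eq_zero.1 h0
        rw [rootMatch_of_eq, hx.1.eq_mate]
        exact Or.inr (linked_top_mate hG.loopless).symm
      · rw [rootMatch_of_ne h0]
        exact Or.inl ((rotGraph_adj_word_iff hG.loopless hr hx).2 ⟨_, rfl⟩)

open Classical in
variable (D) in
/-- The edge of `G` whose replacement seen from the copy with index `j` contains the given vertex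
outside of this copy. -/
noncomputable def outer (j : ZMod r) : RotVert r α β → Option β
  | top => some D.rootEdge
  | old j' _ => if j' = j then none else some D.rootEdge
  | word j' _ e _ => if j' = j then some e else some D.rootEdge

/-- The label given by `outer` can change only by passing through the old vertices of copy `j`. This
makes the walks that replace different edges of `G` disjoint. -/
lemma outer_eq_of_adj {j : ZMod r} {a b : RotVert r α β} (h : (D.rotGraph r).Adj a b) :
    D.outer j a = none ∨ D.outer j b = none ∨ D.outer j a = D.outer j b := by
  obtain ⟨ha, hb, hne, hrel⟩ := ofRel_adj.1 h
  clear h hne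
  wlog hab : D.rel a b generalizing a b
  · have := this hb ha hrel.symm (hrel.resolve_left hab)
    tauto
  rcases hab with ⟨hne, rfl⟩ | ⟨j', v, e, w, d, rfl, rfl⟩
  · match a with
    | top => exact absurd rfl hne
    | old j' v =>
      by_cases hj : j' = j
      · exact Or.inl (by simp [outer, hj])
      · by_cases hv : v = D.root <;> simp [outer, hj, hv, parent]
    | word j' v e [] => exact ha.2.1.elim
    | word j' v e [c] => by_cases hj : j' = j <;> simp [outer, hj, parent]
    | word j' v e (c :: c' :: l) => simp [outer, parent]
  · rcases nbr_cases D d ha with ⟨rfl, rfl, h⟩ | ⟨c, l, rfl, h⟩ | ⟨hd, hl, h⟩ |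
      ⟨hd, hl, w', hf, h⟩ | ⟨hd, rfl, rfl, h⟩ | ⟨hd, rfl, he, h⟩ <;> rw [h]
    · by_cases hj : j' = j <;> simp [outer, hj]
    all_goals simp [outer]

lemma IsTreeEdge.eq_of_isLink {e f : β} {x y : α} (he : D.IsTreeEdge e) (hf : D.IsTreeEdge f)
    (hex : G.IsLink e x y) (hfx : G.IsLink f x y) : e = f := by
  obtain ⟨v, hv, hv', rfl⟩ := he
  obtain ⟨w, hw, hw', rfl⟩ := hf
  have h1 := D.depth_eq v hv hv'
  have h2 := D.depth_eq w hw hw'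
  rcases hex.eq_and_eq_or_eq_and_eq (D.link v hv hv') with ⟨h3, h4⟩ | ⟨h3, h4⟩ <;>
  rcases hfx.eq_and_eq_or_eq_and_eq (D.link w hw hw') with ⟨h5, h6⟩ | ⟨h5, h6⟩
  · rw [← h3, h5]
  · rw [h4.symm.trans h6] at h1
    rw [h5.symm.trans h3] at h2
    omega
  · rw [h3.symm.trans h5] at h1
    rw [h6.symm.trans h4] at h2
    omega
  · rw [← h4, h6]

/-- The color `1` provides a crossing. For an edge other than `rootEdge` it joins the words at both
ends directly. For `rootEdge` the walk leaves the words at `mate` for copy `j + 2`, descends there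
to `mate`, follows the tree to `top` and enters copy `j` at its root. -/
lemma linked_old_old (hG : G.Loopless) (hr : Odd r) (h1 : 1 < r) {j : ZMod r} {e : β} {x y : α}
    (he : ¬ D.IsTreeEdge e) (hxy : G.IsLink e x y) :
    Linked (D.rotGraph r) (fun a => D.outer j a = some e) (old j x) (old j y) := by
  have : Fact (1 < r) := ⟨h1⟩
  have h10 : (1 : ZMod r) ≠ 0 := one_ne_zero
  have hword : ∀ a : RotVert r α β, WordIn j e a → D.outer j a = some e := by
    intro a ha
    cases a with
    | top => exact ha.elim
    | old _ _ => exact ha.elim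
    | word j' v e' w => simp [outer, ha.1, ha.2]
  have hmem : ∀ (i d : ZMod r) (z : α), D.IsHalf e z → d ≠ 0 →
      (word i z e (altWord d (D.len z)) : RotVert r α β) ∈ D.verts := fun i d z h hd =>
    ⟨h, isWord_altWord_len h.vertex_mem hr hd, (length_altWord _ _).le⟩
  by_cases her : e = D.rootEdge
  · subst her
    wlog hx : x = D.root generalizing x y
    · have hx' : x = D.mate :=
        (hxy.inc_left.eq_or_eq_of_isLink D.link_root).resolve_left hx
      subst hx'
      exact (this hxy.symm (hxy.right_unique D.link_root.symm)).symm
    subst hx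
    obtain rfl : y = D.mate := hxy.right_unique D.link_root
    have hm := isHalf_mate (D := D) hG
    have hj : j + 2 * 1 ≠ j := fun h => h10 (two_mul_zmod_injective hr (by simpa using h))
    have l1 : Linked (D.rotGraph r) (fun a => D.outer j a = some D.rootEdge) top
        (old j D.root) := Linked.of_adj_left (rotGraph_adj_top_iff.2 ⟨j, rfl⟩) rfl
    have l2 := (linked_old_top (D := D) (j := j + 2 * 1) hm.vertex_mem).mono
      (N' := fun a => D.outer j a = some D.rootEdge) (by
        intro a ha
        cases a with
        | top => rfl
        | old j' v =>
          have : j' = j + 2 * 1 := ha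
          simp only [outer, this, hj, if_false]
        | word _ _ _ _ => exact ha.elim)
    have l3 := (linked_word_old (hmem (j + 2 * 1) (-1) _ hm (neg_ne_zero.2 h10))).mono
      (N' := fun a => D.outer j a = some D.rootEdge) (by
        intro a ha
        cases a with
        | top => rfl
        | old _ _ => exact ha.elim
        | word j' v e' w => simp only [outer, ha.1, hj, if_false])
    have l4 := (linked_word_old (hmem j 1 _ hm h10)).mono hword
    have l5 : Linked (D.rotGraph r) (fun a => D.outer j a = some D.rootEdge)
        (word j D.mate D.rootEdge (altWord 1 (D.len D.mate)))
        (word (j + 2 * 1) D.mate D.rootEdge (altWord (-1) (D.len D.mate))) :=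
      Linked.of_adj_left ((rotGraph_adj_word_iff hG hr (hmem j 1 _ hm h10)).2
        ⟨1, nbr_altWord_rootEdge hm.vertex_mem hr h10⟩) (hword _ ⟨rfl, rfl⟩)
    exact ((l4.symm.trans l5).trans (l3.trans (l2.trans l1))).symm
  · have hx : D.IsHalf e x := ⟨hxy.inc_left, he, fun h => absurd h her⟩
    have hy : D.IsHalf e y := ⟨hxy.inc_right, he, fun h => absurd h her⟩
    have hother : D.other e x = y := (D.isLink_other hx.inc).right_unique hxy
    have l1 := (linked_word_old (hmem j 1 _ hx h10)).mono hword
    have l2 := (linked_word_old (hmem j 1 _ hy h10)).mono hword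
    refine l1.symm.trans (Linked.trans (Linked.of_adj_left ?_ (hword _ ⟨rfl, rfl⟩)) l2)
    refine (rotGraph_adj_word_iff hG hr (hmem j 1 _ hx h10)).2 ⟨1, ?_⟩
    rw [nbr_altWord hx.vertex_mem hr h10 her, hother]

lemma le_boundary_of_odd_old (hG : G.IsRGraph r) (hr : Odd r) (h1 : 1 < r) {j : ZMod r}
    {S : Set (RotVert r α β)} (hodd : Odd {v | v ∈ V(G) ∧ old j v ∈ S}.ncard) :
    r ≤ ((D.rotGraph r).edgeBoundary S).ncard := by
  refine (hG.le_boundary _ (fun v hv => hv.1) hodd).trans ?_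
  refine ncard_le_ncard_edgeBoundary (finite_verts hG hr)
    (E := fun e a b => (D.rotGraph r).Adj a b ∧ ((D.outer j a = some e ∨ D.outer j b = some e) ∨
      ∃ x y, a = old j x ∧ b = old j y ∧ G.IsLink e x y ∧ D.IsTreeEdge e)) (S := S)
    (fun _ _ _ _ h => h.1) ?_ ?_
  · rintro e - f - a b ⟨hab, h⟩ h'
    have h' : (D.outer j a = some f ∨ D.outer j b = some f) ∨
      ∃ x y, a = old j x ∧ b = old j y ∧ G.IsLink f x y ∧ D.IsTreeEdge f := by
      rcases h' with ⟨-, h'⟩ | ⟨-, h' | ⟨x, y, h1, h2, h3, h4⟩⟩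
      · exact h'
      · exact Or.inl h'.symm
      · exact Or.inr ⟨y, x, h2, h1, h3.symm, h4⟩
    rcases h with h | ⟨x, y, rfl, rfl, hxy, he⟩
    · rcases h' with h' | ⟨x, y, rfl, rfl, hxy, hf⟩
      · have hout := outer_eq_of_adj (j := j) hab
        rcases h with h | h <;> rcases h' with h' | h' <;> simp_all
      · simp [outer] at h
    · rcases h' with h' | ⟨x', y', hx, hy, hxy', hf⟩
      · simp [outer] at h'
      · simp only [old.injEq, true_and] at hx hy
        subst hx hy
        exact he.eq_of_isLink hf hxy hxy'
  · rintro e ⟨x, y, hxy, hx, hy⟩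
    refine ⟨old j x, hx.2, old j y, fun h => hy ⟨hxy.right_mem, h⟩, ?_⟩
    by_cases he : D.IsTreeEdge e
    · refine Relation.ReflTransGen.single ⟨?_, Or.inr ⟨x, y, rfl, rfl, hxy, he⟩⟩
      obtain ⟨v, hv, hne, rfl⟩ := he
      have hadj : (D.rotGraph r).Adj (old j v) (old j (D.par v)) := by
        have := rotGraph_adj_parent (D := D) (x := old j v) hv (by simp)
        simpa [parent, hne] using this
      rcases hxy.eq_and_eq_or_eq_and_eq (D.link v hv hne) with ⟨rfl, rfl⟩ | ⟨rfl, rfl⟩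
      exacts [hadj, hadj.symm]
    · exact Relation.ReflTransGen.mono (fun _ _ h => ⟨h.1, Or.inl h.2⟩) _ _
        (linked_old_old hG.loopless hr h1 he hxy)

open Classical in
variable (D) in
/-- The part of the rotation graph that contains the given vertex. -/
noncomputable def part : RotVert r α β → Option (ZMod r × Option β)
  | top => none
  | old j _ => some (j, none)
  | word j _ e _ => if e = D.rootEdge then none else some (j, some e)

lemma part_eq_none_iff {x : RotVert r α β} (hx : x ∈ D.verts) :
    D.part x = none ↔ x ∈ D.rootPart r := by
  cases x <;> simp [part, rootPart, hx]

lemma part_eq_some_none_iff {x : RotVert r α β} {j : ZMod r} (hx : x ∈ D.verts) :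
    D.part x = some (j, none) ↔ ∃ v ∈ V(G), old j v = x := by
  cases x with
  | top => simp [part]
  | old j' v =>
    simp only [part, Option.some.injEq, Prod.mk.injEq, and_true, old.injEq]
    exact ⟨fun h => ⟨v, hx, h.symm, rfl⟩, fun ⟨v', _, h, _⟩ => h.symm⟩
  | word j' v e w => by_cases he : e = D.rootEdge <;> simp [part, he]

lemma part_eq_some_some_iff {x : RotVert r α β} {j : ZMod r} {e : β} (hx : x ∈ D.verts) :
    D.part x = some (j, some e) ↔ e ≠ D.rootEdge ∧ x ∈ D.wordPart j e := by
  cases x with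
  | top => simp [part, wordPart, WordIn]
  | old j' v => simp [part, wordPart, WordIn]
  | word j' v e' w =>
    by_cases he : e' = D.rootEdge
    · simp only [part, he, if_true, wordPart, mem_ofPred_eq, WordIn]
      simp only [reduceCtorEq, false_iff]
      rintro ⟨h1, -, -, rfl⟩
      exact h1 rfl
    · simp only [part, he, if_false, wordPart, mem_ofPred_eq, WordIn, hx, true_and,
        Option.some.injEq, Prod.mk.injEq]
      exact ⟨fun h => ⟨h.2 ▸ he, h⟩, fun h => h.2⟩

/-- The fibers of `part` are the three kinds of parts, and an odd set meets one of them in an odd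
number of vertices. -/
lemma isRGraph_rotGraph (hG : G.IsRGraph r) (hr : Odd r) (h1 : 1 < r) :
    (D.rotGraph r).IsRGraph r where
  finite_vertexSet := finite_verts hG hr
  finite_edgeSet := finite_edgeSet_ofRel (finite_verts hG hr)
  loopless := simple_ofRel.toLoopless
  regular x hx := degree_rotGraph hG hr hx
  le_boundary S hS hodd := by
    obtain ⟨i, hi⟩ := exists_odd_ncard_fiber ((finite_verts hG hr).subset hS) hodd D.part
    match i with
    | none =>
      refine le_boundary_of_odd_rootPart hG hr (D := D) ?_
      convert! hi using 3
      ext x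
      exact and_congr_right fun hx => (part_eq_none_iff (hS hx)).symm
    | some (j, none) =>
      refine le_boundary_of_odd_old hG hr h1 (D := D) (j := j) ?_
      rw [← ncard_image_of_injective _ (f := old (r := r) (β := β) j)
        fun _ _ h => by injection h]
      convert! hi using 3
      ext x
      constructor
      · rintro ⟨v, ⟨hv, hvS⟩, rfl⟩
        exact ⟨hvS, rfl⟩
      · rintro ⟨hx, hp⟩
        obtain ⟨v, hv, rfl⟩ := (part_eq_some_none_iff (hS hx)).1 hp
        exact ⟨v, ⟨hv, hx⟩, rfl⟩
    | some (j, some e) =>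
      have he : e ≠ D.rootEdge := by
        have hne := Set.nonempty_of_ncard_ne_zero hi.pos.ne'
        obtain ⟨x, hx, hp⟩ := hne
        exact ((part_eq_some_some_iff (hS hx)).1 hp).1
      refine le_boundary_of_odd_wordPart hG hr he (j := j) ?_
      convert! hi using 3
      ext x
      refine and_congr_right fun hx => ?_
      rw [part_eq_some_some_iff (hS hx)]
      exact (and_iff_right he).symm

lemma isRotationRGraph_rotGraph (hG : G.IsRGraph r) (hr : Odd r) (h1 : 1 < r) :
    (D.rotGraph r).IsRotationRGraph r :=
  ⟨isRGraph_rotGraph hG hr h1, D.height + 3, D.rotTree r, ⟨top, trivial⟩, shift 1,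
    rotTree_isSpanningSubgraph, isBalancedTree_rotTree hG hr h1, isAutomorphism_rotGraph,
    isRotational_rotTree hG hr⟩

end RootedTree

/-! ### Restricting perfect matchings to the original graph -/

lemma IsPerfectMatching.mem_iff_mem_of_edgeBoundary_eq {α β : Type*} {H : Graph α β}
    (hH : H.Loopless) (hE : E(H).Finite) {M : Set β} (hM : H.IsPerfectMatching M) {K : Set α}
    (hK : K.Finite) (hKV : K ⊆ V(H)) (heven : Even K.ncard) {e f : β}
    (hb : H.edgeBoundary K = {e, f}) : e ∈ M ↔ f ∈ M := by
  have h := odd_ncard_iff_odd_ncard_inter_edgeBoundary hH (hE.subset hM.subset) hM.subset hK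
    (fun v hv => by
      obtain ⟨g, hg, hu⟩ := hM.existsUnique v (hKV hv)
      have : {e | e ∈ M ∧ H.Inc e v} = {g} := by
        ext e
        exact ⟨fun he => hu e he, fun he => he ▸ hg⟩
      rw [this, ncard_singleton]
      exact odd_one)
  rw [hb] at h
  have heven' : ¬ Odd (M ∩ {e, f}).ncard := fun h' => Nat.not_odd_iff_even.2 heven (h.2 h')
  by_cases he : e ∈ M <;> by_cases hf : f ∈ M
  · exact iff_of_true he hf
  · refine absurd ?_ heven'
    have : M ∩ {e, f} = {e} := by grind
    rw [this, ncard_singleton]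
    exact odd_one
  · refine absurd ?_ heven'
    have : M ∩ {e, f} = {f} := by grind
    rw [this, ncard_singleton]
    exact odd_one
  · exact iff_of_false he hf

namespace RootedTree

open RotVert

variable {α β : Type*} {G : Graph α β} {D : RootedTree G} {r : ℕ}

variable (r D) in
/-- The edge at `old 0 v` that replaces the edge `e` at `v`. -/
noncomputable def lift (v : α) (e : β) : Sym2 (RotVert r α β) := s(old 0 v, D.oldNbr 0 v e)

lemma lift_isLink {v : α} {e : β} (h : G.Inc e v) :
    (D.rotGraph r).IsLink (D.lift r v e) (old 0 v) (D.oldNbr 0 v e) :=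
  isLink_ofRel_of_adj ((rotGraph_adj_old_iff h.vertex_mem).2 ⟨e, h, rfl⟩)

lemma edgeBoundary_wordPart (hG : G.Loopless) (hr : Odd r) {e : β} {x y : α}
    (he : e ≠ D.rootEdge) (hx : D.IsHalf e x) (hy : D.IsHalf e y) (hxy : G.IsLink e x y) :
    (D.rotGraph r).edgeBoundary (D.wordPart 0 e) = {D.lift r x e, D.lift r y e} := by
  have hmem : ∀ v, D.IsHalf e v →
      D.lift r v e ∈ (D.rotGraph r).edgeBoundary (D.wordPart 0 e) := by
    intro v hv
    refine ⟨_, _, (lift_isLink hv.inc).symm, ?_, fun h => h.2⟩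
    rw [hv.oldNbr]
    exact ⟨word_singleton_mem hv, rfl, rfl⟩
  apply Subset.antisymm
  · rintro f ⟨a, b, hab, ⟨ha, hw⟩, hb⟩
    obtain ⟨rfl, hadj⟩ := ofRel_isLink_iff.1 hab
    match a with
    | top => exact hw.elim
    | old _ _ => exact hw.elim
    | word j v e' w =>
      obtain ⟨rfl, rfl⟩ := hw
      obtain ⟨d, rfl⟩ := (rotGraph_adj_word_iff hG hr ha).1 hadj
      by_cases h0 : w = [0] ∧ d = 0
      · obtain ⟨rfl, rfl⟩ := h0
        have hl : s(word 0 v e' [0], D.nbr 0 v e' [0] 0) = D.lift r v e' := by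
          rw [nbr_zero, lift, ha.1.oldNbr, Sym2.eq_swap]
        rw [hl]
        rcases ha.1.inc.eq_or_eq_of_isLink hxy with rfl | rfl
        exacts [Or.inl rfl, Or.inr rfl]
      · obtain ⟨j₁, v₁, w₁, d₁, h1, h2, -, -, -, h6⟩ := exists_nbr_eq hr ha h0
        obtain rfl := h6 he
        rw [h1] at hb
        exact absurd ⟨h2, rfl, rfl⟩ hb
  · rintro f (rfl | rfl)
    exacts [hmem x hx, hmem y hy]

variable (r D) in
/-- The copy of `G - rootEdge` with index `0`. -/
def zeroCopy : Set (RotVert r α β) := {x | x ∈ D.verts ∧ ∃ i, D.part x = some (0, i)}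

/-- Each part of the copy is even: the words of an edge have a perfect matching, and `V(G)` has an
empty cut, so it cannot be odd. -/
lemma even_ncard_zeroCopy (hG : G.IsRGraph r) (hr : Odd r) : Even (D.zeroCopy r).ncard := by
  rw [← Nat.not_odd_iff_even]
  intro hodd
  obtain ⟨i, hi⟩ := exists_odd_ncard_fiber
    ((finite_verts hG hr).subset fun x hx => hx.1) hodd D.part
  obtain ⟨x₀, ⟨hx₀, i₀, hi₀⟩, hp₀⟩ := Set.nonempty_of_ncard_ne_zero hi.pos.ne'
  rw [hp₀] at hi₀
  subst hi₀
  match i₀ with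
  | none =>
    have hV : ¬ Odd V(G).ncard := fun h => by
      have h1 := hG.le_boundary V(G) subset_rfl h
      have h2 : G.edgeBoundary V(G) = ∅ := by
        ext e
        simp only [mem_empty_iff_false, iff_false]
        rintro ⟨x, y, hxy, _, hy⟩
        exact hy hxy.right_mem
      rw [h2, ncard_empty] at h1
      have := hr.pos
      omega
    refine hV ?_
    rw [← ncard_image_of_injective _ (f := old (r := r) (β := β) 0)
      fun _ _ h => by injection h]
    convert! hi using 3
    ext x
    constructor
    · rintro ⟨v, hv, rfl⟩
      exact ⟨⟨hv, _, rfl⟩, rfl⟩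
    · rintro ⟨hx, hp⟩
      exact (part_eq_some_none_iff hx.1).1 hp
  | some e =>
    have he := ((part_eq_some_some_iff hx₀).1 hp₀).1
    refine Nat.not_even_iff_odd.2 hi ?_
    convert! even_ncard_wordPart hG hr he (D := D) (j := 0) using 3
    ext x
    constructor
    · rintro ⟨hx, hp⟩
      exact ((part_eq_some_some_iff hx.1).1 hp).2
    · intro hx
      have hp := (part_eq_some_some_iff hx.1).2 ⟨he, hx⟩
      exact ⟨⟨hx.1, _, hp⟩, hp⟩

lemma edgeBoundary_zeroCopy (hG : G.Loopless) (hr : Odd r) :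
    (D.rotGraph r).edgeBoundary (D.zeroCopy r) =
      {D.lift r D.root D.rootEdge, D.lift r D.mate D.rootEdge} := by
  have hm := isHalf_mate (D := D) hG
  apply Subset.antisymm
  · rintro f ⟨a, b, hab, ⟨ha, i, hp⟩, hb⟩
    obtain ⟨rfl, hadj⟩ := ofRel_isLink_iff.1 hab
    match a with
    | top => simp [part] at hp
    | old j v =>
      obtain rfl : j = 0 := by simp only [part, Option.some.injEq, Prod.mk.injEq] at hp; exact hp.1
      obtain ⟨e, he, rfl⟩ := (rotGraph_adj_old_iff ha).1 hadj
      rcases inc_cases (D := D) he with ⟨rfl, rfl⟩ | ⟨hv', rfl⟩ | ⟨w, hw, hne, rfl, rfl⟩ | hh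
      · exact Or.inl rfl
      · rw [oldNbr_edge hv'] at hb
        exact absurd ⟨D.par_mem ha hv', none, rfl⟩ hb
      · rw [oldNbr_edge_par hw hne] at hb
        exact absurd ⟨hw, none, rfl⟩ hb
      · by_cases her : e = D.rootEdge
        · subst her
          obtain rfl := hh.eq_mate
          exact Or.inr rfl
        · rw [hh.oldNbr] at hb
          exact absurd ⟨word_singleton_mem hh, some e, if_neg her⟩ hb
    | word j v e w =>
      by_cases her : e = D.rootEdge
      · simp [part, her] at hp
      obtain rfl : j = 0 := by
        simp only [part, her, if_false, Option.some.injEq, Prod.mk.injEq] at hp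
        exact hp.1
      obtain ⟨d, rfl⟩ := (rotGraph_adj_word_iff hG hr ha).1 hadj
      by_cases h0 : w = [0] ∧ d = 0
      · obtain ⟨rfl, rfl⟩ := h0
        rw [nbr_zero] at hb
        exact absurd ⟨ha.1.vertex_mem, none, rfl⟩ hb
      · obtain ⟨j₁, v₁, w₁, d₁, h1, h2, -, -, -, h6⟩ := exists_nbr_eq hr ha h0
        obtain rfl := h6 her
        rw [h1] at hb
        exact absurd ⟨h2, some e, if_neg her⟩ hb
  · rintro f (rfl | rfl)
    · refine ⟨_, _, lift_isLink D.link_root.inc_left, ⟨D.root_mem, none, rfl⟩, ?_⟩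
      rw [oldNbr_rootEdge]
      rintro ⟨-, i, hi⟩
      simp [part] at hi
    · refine ⟨_, _, lift_isLink hm.inc, ⟨hm.vertex_mem, none, rfl⟩, ?_⟩
      rw [hm.oldNbr]
      rintro ⟨-, i, hi⟩
      simp [part] at hi

/-- For a tree edge both lifts are the same edge. Otherwise they form the cut of an even set: the
words at the edge or, for `rootEdge`, the rest of the copy. -/
lemma lift_mem_iff (hG : G.IsRGraph r) (hr : Odd r) {M : Set (Sym2 (RotVert r α β))}
    (hM : (D.rotGraph r).IsPerfectMatching M) {e : β} {x y : α} (hxy : G.IsLink e x y) :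
    D.lift r x e ∈ M ↔ D.lift r y e ∈ M := by
  have hl := hG.loopless
  have hH : (D.rotGraph r).Loopless := simple_ofRel.toLoopless
  have hE : E(D.rotGraph r).Finite := finite_edgeSet_ofRel (finite_verts hG hr)
  by_cases he : D.IsTreeEdge e
  · have : D.lift r x e = D.lift r y e := by
      obtain ⟨v, hv, hne, rfl⟩ := he
      have hv' : D.lift r v (D.edge v) = D.lift r (D.par v) (D.edge v) := by
        rw [lift, lift, oldNbr_edge hne, oldNbr_edge_par hv hne, Sym2.eq_swap]
      rcases hxy.eq_and_eq_or_eq_and_eq (D.link v hv hne) with ⟨rfl, rfl⟩ | ⟨rfl, rfl⟩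
      exacts [hv', hv'.symm]
    rw [this]
  by_cases her : e = D.rootEdge
  · subst her
    have key : D.lift r D.root D.rootEdge ∈ M ↔ D.lift r D.mate D.rootEdge ∈ M :=
      hM.mem_iff_mem_of_edgeBoundary_eq hH hE
        ((finite_verts hG hr).subset fun x hx => hx.1) (fun x hx => hx.1)
        (even_ncard_zeroCopy hG hr) (edgeBoundary_zeroCopy hl hr)
    rcases hxy.eq_and_eq_or_eq_and_eq D.link_root with ⟨rfl, rfl⟩ | ⟨rfl, rfl⟩
    exacts [key, key.symm]
  · have hx : D.IsHalf e x := ⟨hxy.inc_left, he, fun h => absurd h her⟩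
    have hy : D.IsHalf e y := ⟨hxy.inc_right, he, fun h => absurd h her⟩
    exact hM.mem_iff_mem_of_edgeBoundary_eq hH hE (finite_wordPart hG hr) (fun x hx => hx.1)
      (even_ncard_wordPart hG hr her) (edgeBoundary_wordPart hl hr her hx hy hxy)

/-- The edges at `old 0 v` are the lifts of the edges at `v`, so being matched once is inherited.
Membership of an edge can be tested on a single lift, which gives the same bound `k`. -/
lemma hasPerfectMatchings_of_rotGraph (hG : G.IsRGraph r) (hr : Odd r) {k : ℕ}
    (h : (D.rotGraph r).HasPerfectMatchings r k) : G.HasPerfectMatchings r k := by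
  obtain ⟨M, hM, hk⟩ := h
  have hiff : ∀ j e v, G.Inc e v →
      ((∃ x, G.Inc e x ∧ D.lift r x e ∈ M j) ↔ D.lift r v e ∈ M j) := by
    rintro j e v ⟨u, hu⟩
    refine ⟨?_, fun h => ⟨v, ⟨u, hu⟩, h⟩⟩
    rintro ⟨x, hx, hxM⟩
    rcases hx.eq_or_eq_of_isLink hu with rfl | rfl
    · exact hxM
    · exact (lift_mem_iff hG hr (hM j) hu).2 hxM
  refine ⟨fun j => {e | ∃ x, G.Inc e x ∧ D.lift r x e ∈ M j}, fun j => ⟨?_, ?_⟩, ?_⟩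
  · rintro e ⟨x, hx, _⟩
    exact hx.edge_mem
  · intro v hv
    obtain ⟨f, ⟨hf, y, hy⟩, hu⟩ := (hM j).existsUnique (old 0 v) hv
    obtain ⟨rfl, hadj⟩ := ofRel_isLink_iff.1 hy
    obtain ⟨e, he, rfl⟩ := (rotGraph_adj_old_iff hv).1 hadj
    refine ⟨e, ⟨⟨v, he, hf⟩, he⟩, ?_⟩
    rintro e' ⟨he', hv'⟩
    have := hu (D.lift r v e') ⟨(hiff j e' v hv').1 he', (lift_isLink hv').inc_left⟩
    exact oldNbr_injOn hv' he (Sym2.congr_right.1 this)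
  · intro e he
    obtain ⟨x, y, hxy⟩ := exists_isLink_of_mem_edgeSet he
    have : {j | e ∈ {e | ∃ x, G.Inc e x ∧ D.lift r x e ∈ M j}} = {j | D.lift r x e ∈ M j} := by
      ext j
      exact hiff j e x hxy.inc_left
    rw [this]
    exact hk _ (lift_isLink hxy.inc_left).edge_mem

end RootedTree

/-- Induction on the number of vertices: the component of a vertex is settled by its rotation graph,
the rest by the induction hypothesis. -/
lemma IsRGraph.hasPerfectMatchings_of_rotationRGraph {r k : ℕ} (hr : Odd r) (h1 : 1 < r)
    (h : ∀ (α β : Type u) (G : Graph α β), G.IsRotationRGraph r → G.Simple →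
      G.HasPerfectMatchings r k) {α β : Type u} {G : Graph α β} (hG : G.IsRGraph r) :
    G.HasPerfectMatchings r k := by
  induction hn : V(G).ncard using Nat.strong_induction_on generalizing G with
  | _ n ih =>
    rcases V(G).eq_empty_or_nonempty with hV | ⟨v₀, hv₀⟩
    · refine ⟨fun _ => ∅, fun _ => ⟨empty_subset _, fun v hv => ?_⟩, fun e _ => by simp⟩
      rw [hV] at hv
      exact hv.elim
    obtain ⟨C, hCV, hvC, hC, ⟨D⟩⟩ := hG.exists_rootedTree hr h1 hv₀
    have hGC := hG.induce hCV hC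
    refine HasPerfectMatchings.of_induce hC hCV ?_ ?_
    · exact D.hasPerfectMatchings_of_rotGraph hGC hr
        (h _ _ _ (D.isRotationRGraph_rotGraph hGC hr h1) simple_ofRel)
    · refine ih _ ?_ (hG.induce sdiff_subset (edgeBoundary_diff_eq_empty hC)) rfl
      rw [← hn]
      exact ncard_lt_ncard (ssubset_of_subset_of_ne sdiff_subset fun h =>
        ((Set.ext_iff.1 h v₀).2 hv₀ : v₀ ∈ V(G) \ C).2 hvC) hG.finite_vertexSet

end Graph

theorem mainTheorem4 (r k : ℕ) (hr : Odd r) (hk : 2 ≤ k) (hkr : k ≤ r - 1) :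
    (∀ (α β : Type u) (G : Graph α β), G.IsRGraph r → G.HasPerfectMatchings r k) ↔
      (∀ (α β : Type u) (G : Graph α β), G.IsRotationRGraph r → G.Simple →
        G.HasPerfectMatchings r k) := by
  refine ⟨fun h α β G hG _ => h α β G hG.1, fun h α β G hG => ?_⟩
  exact hG.hasPerfectMatchings_of_rotationRGraph hr (by omega) h
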